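/- Let $n\in\mathbb N$ and let $\mathcal J_n=\{i\kappa : i\in\{-1,1\},\ \kappa\in\{1,\dots,n\}\}$, with the fixed point free involution $\overline{i\kappa}=\bar i\kappa$, $\bar i=-i$. Let $\mathbb G$ be a compact quantum group, given by a unital $C^*$-algebra $C(\mathbb G)$ and a coassociative unital $^*$-homomorphism $\Delta:C(\mathbb G)\to C(\mathbb G)\otimes C(\mathbb G)$ (spatial tensor product) satisfying the quantum cancellation rules. Let $U=(U_{x,z})_{x,z\in\mathcal J_n}$ be a fundamental unitary representation of $\mathbb G$: $U$ is a unitary matrix over $C(\mathbb G)$, $\Delta(U_{x,z})=\sum_y U_{x,y}\otimes U_{y,z}$, and the entries of $U$ generate $C(\mathbb G)$ as a $C^*$-algebra. Assume that $U$ satisfies the defining conditions of the fundamental representation of $H^+(n,0)$: each $U_{x,z}$ is a partial isometry and $U_{x,z}=U_{\bar x,\bar z}^*$ for all $x,z\in\mathcal J_n$. Let $\gamma_1,\dots,\gamma_n$ be the canonical generators of the free group $\mathbb F_n$. There is exactly one action $\alpha:C^*(\mathbb F_n)\to C^*(\mathbb F_n)\otimes C(\mathbb G)$ of $\mathbb G$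 on the full group $C^*$-algebra (a unital $^*$-homomorphism with $(\alpha\otimes\mathrm{id})\alpha=(\mathrm{id}\otimes\Delta)\alpha$ and with $\mathrm{Lin}\,\alpha(C^*(\mathbb F_n))(1\otimes C(\mathbb G))$ dense in $C^*(\mathbb F_n)\otimes C(\mathbb G)$) such that $$\alpha(\gamma_\kappa)=\sum_{i\sigma\in\mathcal J_n}\gamma_\sigma^{\,i}\otimes U_{i\sigma,1\kappa},\qquad \kappa=1,\dots,n.$$ Every $\gamma\in\mathbb F_n$ can be written uniquely as $\gamma=\gamma_{\sigma_1}^{k_1}\cdots\gamma_{\sigma_m}^{k_m}$ with $m\ge 0$, $k_j\in\mathbb Z\setminus\{0\}$ and $\sigma_j\ne\sigma_{j+1}$. Its word length is $l(\gamma)=|k_1|+\dots+|k_m|$, its block length is $b(\gamma)=m$, and its shape is the sequence $s(\gamma)=(|k_1|,\,|k_1|+|k_2|,\,\dots,\,|k_1|+\dots+|k_m|)$ (empty for $\gamma=e$). For $\gamma'\in\mathbb F_n$ let $f_{\gamma'}:\mathbb C[\mathbb F_n]\odot C(\mathbb G)\to C(\mathbb G)$ be the linear map with $f_{\gamma'}(\gamma''\otimes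 a)=\delta_{\gamma',\gamma''}a$. For a set $S\subseteq\mathbb F_n$ and a function $\varphi$ on $\mathbb F_n$, say that $\alpha$ preserves $\varphi$ on $S$ if for each $\gamma\in S$ one has $\alpha(\gamma)\in\mathbb C[\mathbb F_n]\odot C(\mathbb G)$ and $f_{\gamma'}(\alpha(\gamma))=0$ for all $\gamma'\in\mathbb F_n$ with $\varphi(\gamma')\neq\varphi(\gamma)$. Then the following conditions are equivalent: (i) the operator $T$ on $\mathbb C^{2n}\otimes\mathbb C^{2n}$ (where $(e_z)_{z\in\mathcal J_n}$ is the canonical basis of $\mathbb C^{2n}$) given by $T(e_z\otimes e_x)=\delta_{z,\bar x}\,e_{\bar z}\otimes e_z$ for $x,z\in\mathcal J_n$ belongs to $\mathrm{Hom}(U^{\otimes 2};U^{\otimes 2})$, that is, $(T\otimes 1)U^{\otimes 2}=U^{\otimes 2}(T\otimes 1)$, where $U^{\otimes 2}$ is the matrix with entries $(U^{\otimes 2})_{(a,b),(z,x)}=U_{a,z}U_{b,x}$; (ii) each $U_{x,z}$ is normal; (iii) $\alpha$ preserves the block length $b$ on the set of the elements $\gamma$ with $b(\gamma)=l(\gamma)=2$;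 (iv) $\alpha$ preserves the block length $b$ on $\mathbb F_n$; (v) $\alpha$ preserves the shape $s$ on $\mathbb F_n$. -/

import Mathlib

open scoped TensorProduct Kronecker

universe u v w

set_option linter.unusedSectionVars false

noncomputable section

/-! ### C*-seminorms on *-algebras and the C*-algebras that they define -/

/-- A C*-seminorm on a unital complex *-algebra. -/
structure CStarSeminorm (R : Type*) [Ring R] [StarRing R] [Algebra ℂ R] [StarModule ℂ R] where
  toFun : R → ℝ
  add_le : ∀ x y, toFun (x + y) ≤ toFun x + toFun y
  smul_eq : ∀ (c : ℂ) x, toFun (c • x) = ‖c‖ * toFun x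
  mul_le : ∀ x y, toFun (x * y) ≤ toFun x * toFun y
  star_eq : ∀ x, toFun (star x) = toFun x
  le_star_mul_self : ∀ x, toFun x * toFun x ≤ toFun (star x * x)

namespace CStarSeminorm

variable {R : Type*} [Ring R] [StarRing R] [Algebra ℂ R] [StarModule ℂ R]

/-- The *-algebra `R`, regarded as a seminormed space through `p`. -/
def Pre (_p : CStarSeminorm R) : Type _ := R

variable (p : CStarSeminorm R)

instance : Ring p.Pre := inferInstanceAs (Ring R)
instance : StarRing p.Pre := inferInstanceAs (StarRing R)
instance : Algebra ℂ p.Pre := inferInstanceAs (Algebra ℂ R)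
instance : StarModule ℂ p.Pre := inferInstanceAs (StarModule ℂ R)

theorem map_zero : p.toFun 0 = 0 := by
  simpa using p.smul_eq 0 0

theorem map_neg (x : R) : p.toFun (-x) = p.toFun x := by
  simpa using p.smul_eq (-1) x

instance : SeminormedRing p.Pre where
  __ : Ring p.Pre := inferInstance
  __ : SeminormedAddCommGroup p.Pre := AddGroupSeminorm.toSeminormedAddCommGroup
    ({ toFun := p.toFun
       map_zero' := p.map_zero
       add_le' := p.add_le
       neg' := p.map_neg } : AddGroupSeminorm p.Pre)
  norm_mul_le := p.mul_le

theorem norm_def (x : p.Pre) : ‖x‖ = p.toFun x := rfl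

instance : NormedSpace ℂ p.Pre where
  norm_smul_le c x := (p.smul_eq c x).le

theorem isometry_star : Isometry (star : p.Pre → p.Pre) :=
  AddMonoidHomClass.isometry_of_norm (starAddEquiv : p.Pre ≃+ p.Pre) p.star_eq

/-- The C*-algebra obtained from `R` by separation and completion with respect to `p`. -/
abbrev Completion : Type _ := UniformSpace.Completion p.Pre

instance : NormedAlgebra ℂ p.Completion where
  norm_smul_le := norm_smul_le

instance : Star p.Completion := ⟨UniformSpace.Completion.map (star : p.Pre → p.Pre)⟩

/-- The canonical map of `R` into the completion, as a function. -/
def coe (x : R) : p.Completion := UniformSpace.Completion.coe' (show p.Pre from x)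

theorem denseRange_coe : DenseRange p.coe :=
  UniformSpace.Completion.denseRange_coe (α := p.Pre)

theorem norm_coe (x : R) : ‖p.coe x‖ = p.toFun x :=
  UniformSpace.Completion.norm_coe (E := p.Pre) x

theorem star_coe (x : R) : star (p.coe x) = p.coe (star x) :=
  UniformSpace.Completion.map_coe (p.isometry_star.uniformContinuous) (x : p.Pre)

theorem continuous_star : Continuous (star : p.Completion → p.Completion) :=
  UniformSpace.Completion.continuous_map (f := (star : p.Pre → p.Pre))

theorem coe_add (x y : R) : p.coe (x + y) = p.coe x + p.coe y :=
  UniformSpace.Completion.coe_add (α := p.Pre) x y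

theorem coe_mul (x y : R) : p.coe (x * y) = p.coe x * p.coe y :=
  UniformSpace.Completion.coe_mul (α := p.Pre) x y

theorem coe_smul (c : ℂ) (x : R) : p.coe (c • x) = c • p.coe x :=
  UniformSpace.Completion.coe_smul (X := p.Pre) c x

theorem completion_induction {P : p.Completion → Prop} (x : p.Completion)
    (hc : IsClosed {x | P x}) (h : ∀ x, P (p.coe x)) : P x :=
  isClosed_property p.denseRange_coe hc h x

theorem completion_induction₂ {P : p.Completion → p.Completion → Prop} (x y : p.Completion)
    (hc : IsClosed {z : p.Completion × p.Completion | P z.1 z.2})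
    (h : ∀ x y, P (p.coe x) (p.coe y)) : P x y :=
  isClosed_property2 p.denseRange_coe hc h x y

instance : StarRing p.Completion where
  star_involutive x := p.completion_induction (P := fun x => star (star x) = x) x
    (isClosed_eq (p.continuous_star.comp p.continuous_star) continuous_id)
    fun x => by simp [star_coe]
  star_mul x y := p.completion_induction₂
    (P := fun x y => star (x * y) = star y * star x) x y
    (isClosed_eq (p.continuous_star.comp (continuous_fst.mul continuous_snd))
      ((p.continuous_star.comp continuous_snd).mul (p.continuous_star.comp continuous_fst)))
    fun x y => by simp only [star_coe, ← coe_mul, star_mul]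
  star_add x y := p.completion_induction₂
    (P := fun x y => star (x + y) = star x + star y) x y
    (isClosed_eq (p.continuous_star.comp (continuous_fst.add continuous_snd))
      ((p.continuous_star.comp continuous_fst).add (p.continuous_star.comp continuous_snd)))
    fun x y => by simp only [star_coe, ← coe_add, star_add]

instance : CStarAlgebra p.Completion where
  norm_mul_self_le x := p.completion_induction (P := fun x => ‖x‖ * ‖x‖ ≤ ‖star x * x‖) x
    (isClosed_le (continuous_norm.mul continuous_norm)
      (continuous_norm.comp (p.continuous_star.mul continuous_id)))
    fun x => by
      rw [star_coe, ← coe_mul, norm_coe, norm_coe]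
      exact p.le_star_mul_self x
  star_smul c x := p.completion_induction (P := fun x => star (c • x) = star c • star x) x
    (isClosed_eq (p.continuous_star.comp (continuous_const_smul c))
      ((continuous_const_smul (star c)).comp p.continuous_star))
    fun x => by simp only [star_coe, ← coe_smul, star_smul]

/-- The canonical *-homomorphism of `R` into the completion. -/
def ι : R →⋆ₐ[ℂ] p.Completion where
  toFun := p.coe
  map_one' := rfl
  map_mul' := p.coe_mul
  map_zero' := rfl
  map_add' := p.coe_add
  commutes' _ := rfl
  map_star' x := (p.star_coe x).symm

theorem ι_apply (x : R) : p.ι x = p.coe x := rfl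

variable {D : Type*} [CStarAlgebra D]

/-- The extension to the completion of a *-homomorphism that is contractive for `p`. -/
def lift (f : R →⋆ₐ[ℂ] D) (hf : ∀ x, ‖f x‖ ≤ p.toFun x) : p.Completion →⋆ₐ[ℂ] D :=
  have hcont : Continuous (show p.Pre →+* D from (f : R →+* D)) :=
    AddMonoidHomClass.continuous_of_bound (show p.Pre →+* D from (f : R →+* D)) 1
      (fun x => by simpa using! hf x)
  let g : p.Completion →+* D :=
    UniformSpace.Completion.extensionHom (show p.Pre →+* D from (f : R →+* D)) hcont
  have hg : ∀ x : R, g (p.coe x) = f x := fun x =>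
    UniformSpace.Completion.extensionHom_coe (show p.Pre →+* D from (f : R →+* D)) hcont x
  have hgc : Continuous g := UniformSpace.Completion.continuous_extension
  { g with
    commutes' := fun c => by
      have h := hg (algebraMap ℂ R c)
      rw [AlgHomClass.commutes] at h
      exact h
    map_star' := fun x => p.completion_induction (P := fun x => g (star x) = star (g x)) x
      (isClosed_eq (hgc.comp p.continuous_star) hgc.star)
      fun x => by
        rw [star_coe, hg, hg, map_star] }

theorem lift_ι (f : R →⋆ₐ[ℂ] D) (hf : ∀ x, ‖f x‖ ≤ p.toFun x) (x : R) :
    p.lift f hf (p.ι x) = f x :=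
  UniformSpace.Completion.extensionHom_coe (show p.Pre →+* D from (f : R →+* D))
    (AddMonoidHomClass.continuous_of_bound (show p.Pre →+* D from (f : R →+* D)) 1
      (fun x => by simpa using! hf x)) x

/-- The supremum of the norms `‖θ i x‖` over a pointwise bounded family of *-homomorphisms
into C*-algebras. -/
def ofFamily {I : Type*} {D : I → Type*} [∀ i, CStarAlgebra (D i)]
    (θ : ∀ i, R →⋆ₐ[ℂ] D i) (hb : ∀ x, BddAbove (Set.range fun i => ‖θ i x‖)) :
    CStarSeminorm R where
  toFun x := ⨆ i, ‖θ i x‖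
  add_le x y := Real.iSup_le (fun i => by
      rw [_root_.map_add]
      exact (norm_add_le _ _).trans (add_le_add (le_ciSup (hb x) i) (le_ciSup (hb y) i)))
    (add_nonneg (Real.iSup_nonneg fun _ => norm_nonneg _)
      (Real.iSup_nonneg fun _ => norm_nonneg _))
  smul_eq c x := by
    rw [Real.mul_iSup_of_nonneg (norm_nonneg c)]
    simp only [_root_.map_smul, norm_smul]
  mul_le x y := Real.iSup_le (fun i => by
      rw [_root_.map_mul]
      exact (norm_mul_le _ _).trans (mul_le_mul (le_ciSup (hb x) i) (le_ciSup (hb y) i)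
        (norm_nonneg _) (Real.iSup_nonneg fun _ => norm_nonneg _)))
    (mul_nonneg (Real.iSup_nonneg fun _ => norm_nonneg _)
      (Real.iSup_nonneg fun _ => norm_nonneg _))
  star_eq x := by simp only [StarHomClass.map_star, norm_star]
  le_star_mul_self x := by
    have h0 : 0 ≤ ⨆ i, ‖θ i (star x * x)‖ := Real.iSup_nonneg fun _ => norm_nonneg _
    have h1 : (⨆ i, ‖θ i x‖) ≤ √(⨆ i, ‖θ i (star x * x)‖) :=
      Real.iSup_le (fun i => Real.le_sqrt_of_sq_le (by
        have h2 := le_ciSup (hb (star x * x)) i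
        have h3 : ‖θ i (star x * x)‖ = ‖θ i x‖ ^ 2 := by
          rw [_root_.map_mul, StarHomClass.map_star, CStarRing.norm_star_mul_self, sq]
        exact h3 ▸ h2))
        (Real.sqrt_nonneg _)
    calc _ ≤ √(⨆ i, ‖θ i (star x * x)‖) * √(⨆ i, ‖θ i (star x * x)‖) :=
          mul_self_le_mul_self (Real.iSup_nonneg fun _ => norm_nonneg _) h1
      _ = _ := Real.mul_self_sqrt h0

end CStarSeminorm

/-! ### The spatial (minimal) tensor product of C*-algebras -/

section SpatialTensor

/-- The Hilbert space tensor product. -/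
def HilbertTensor (H K : Type*) [NormedAddCommGroup H] [InnerProductSpace ℂ H]
    [NormedAddCommGroup K] [InnerProductSpace ℂ K] : Type _ :=
  UniformSpace.Completion (H ⊗[ℂ] K)

namespace HilbertTensor

variable (H K : Type*) [NormedAddCommGroup H] [InnerProductSpace ℂ H]
  [NormedAddCommGroup K] [InnerProductSpace ℂ K]

instance : NormedAddCommGroup (HilbertTensor H K) :=
  inferInstanceAs (NormedAddCommGroup (UniformSpace.Completion (H ⊗[ℂ] K)))
instance : InnerProductSpace ℂ (HilbertTensor H K) :=
  inferInstanceAs (InnerProductSpace ℂ (UniformSpace.Completion (H ⊗[ℂ] K)))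
instance : CompleteSpace (HilbertTensor H K) :=
  inferInstanceAs (CompleteSpace (UniformSpace.Completion (H ⊗[ℂ] K)))

/-- The isometric embedding of the algebraic tensor product. -/
def incl : H ⊗[ℂ] K →ₗᵢ[ℂ] HilbertTensor H K :=
  (UniformSpace.Completion.toComplₗᵢ :
    H ⊗[ℂ] K →ₗᵢ[ℂ] UniformSpace.Completion (H ⊗[ℂ] K))

theorem denseRange_incl : DenseRange (incl H K) :=
  UniformSpace.Completion.denseRange_coe (α := H ⊗[ℂ] K)

end HilbertTensor

section Operators

variable {H K : Type*} [NormedAddCommGroup H] [InnerProductSpace ℂ H] [CompleteSpace H]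
  [NormedAddCommGroup K] [InnerProductSpace ℂ K] [CompleteSpace K]

theorem inner_map_adjoint (S : H →L[ℂ] H) (T : K →L[ℂ] K) (x y : H ⊗[ℂ] K) :
    inner ℂ (TensorProduct.map (star S).toLinearMap (star T).toLinearMap x) y =
      inner ℂ x (TensorProduct.map S.toLinearMap T.toLinearMap y) := by
  induction x with
  | zero => simp
  | add x₁ x₂ h₁ h₂ => simp only [map_add, inner_add_left, h₁, h₂]
  | tmul a b =>
    induction y with
    | zero => simp
    | add y₁ y₂ h₁ h₂ => simp only [map_add, inner_add_right, h₁, h₂]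
    | tmul c d =>
      simp [ContinuousLinearMap.star_eq_adjoint, ContinuousLinearMap.adjoint_inner_left]

theorem norm_map_left_le (S : H →L[ℂ] H) (x : H ⊗[ℂ] K) :
    ‖TensorProduct.map S.toLinearMap (1 : K →L[ℂ] K).toLinearMap x‖ ≤ ‖S‖ * ‖x‖ := by
  have hpos : (0 : H →L[ℂ] H) ≤ algebraMap ℝ (H →L[ℂ] H) (‖S‖ ^ 2) - star S * S :=
    sub_nonneg.mpr CStarAlgebra.star_mul_le_algebraMap_norm_sq
  obtain ⟨C, hC⟩ := CStarAlgebra.nonneg_iff_eq_star_mul_self.mp hpos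
  have hcomp : ∀ V : H →L[ℂ] H, inner ℂ (TensorProduct.map V.toLinearMap
      (1 : K →L[ℂ] K).toLinearMap x) (TensorProduct.map V.toLinearMap
      (1 : K →L[ℂ] K).toLinearMap x) = inner ℂ x (TensorProduct.map (star V * V).toLinearMap
      (1 : K →L[ℂ] K).toLinearMap x) := fun V => by
    have h := inner_map_adjoint (star V) (1 : K →L[ℂ] K) x
      (TensorProduct.map V.toLinearMap (1 : K →L[ℂ] K).toLinearMap x)
    rw [star_star, star_one] at h
    rw [h, ← LinearMap.comp_apply, ← TensorProduct.map_comp]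
    rfl
  have hS := hcomp S
  have hC' := hcomp C
  rw [← hC] at hC'
  have hsub : TensorProduct.map (algebraMap ℝ (H →L[ℂ] H) (‖S‖ ^ 2) - star S * S).toLinearMap
      (1 : K →L[ℂ] K).toLinearMap x = ((‖S‖ ^ 2 : ℝ) : ℂ) • x -
      TensorProduct.map (star S * S).toLinearMap (1 : K →L[ℂ] K).toLinearMap x := by
    clear hS hC' hcomp
    induction x with
    | zero => simp
    | add x y hx hy =>
      rw [map_add, map_add, smul_add, hx, hy]
      abel
    | tmul a b =>
      have h : ((‖S‖ ^ 2 : ℝ) : ℂ) • a = (‖S‖ ^ 2 : ℝ) • a := Complex.coe_smul _ _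
      rw [TensorProduct.smul_tmul', h]
      simp [Algebra.algebraMap_eq_smul_one, TensorProduct.sub_tmul]
  have hsc : inner ℂ x (((‖S‖ ^ 2 : ℝ) : ℂ) • x) = ((‖S‖ ^ 2 : ℝ) : ℂ) * inner ℂ x x :=
    inner_smul_right (𝕜 := ℂ) x x _
  have hn : ∀ y : H ⊗[ℂ] K, inner ℂ y y = ((‖y‖ ^ 2 : ℝ) : ℂ) := fun y => by
    exact (inner_self_eq_norm_sq_to_K (𝕜 := ℂ) y).trans (by push_cast; rfl)
  rw [hsub, inner_sub_right, hsc, ← hS, hn, hn, hn, ← Complex.ofReal_mul,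
    ← Complex.ofReal_sub, Complex.ofReal_inj] at hC'
  refine abs_le_of_sq_le_sq' ?_ (by positivity) |>.2
  nlinarith [sq_nonneg ‖TensorProduct.map C.toLinearMap (1 : K →L[ℂ] K).toLinearMap x‖]

theorem norm_map_comm (S : H →L[ℂ] H) (T : K →L[ℂ] K) (x : H ⊗[ℂ] K) :
    ‖TensorProduct.map S.toLinearMap T.toLinearMap x‖ =
      ‖TensorProduct.map T.toLinearMap S.toLinearMap (TensorProduct.comm ℂ H K x)‖ := by
  rw [← TensorProduct.norm_comm, TensorProduct.map_comm]

theorem norm_map_le (S : H →L[ℂ] H) (T : K →L[ℂ] K) (x : H ⊗[ℂ] K) :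
    ‖TensorProduct.map S.toLinearMap T.toLinearMap x‖ ≤ ‖S‖ * ‖T‖ * ‖x‖ := by
  have h : TensorProduct.map S.toLinearMap T.toLinearMap x =
      TensorProduct.map S.toLinearMap (1 : K →L[ℂ] K).toLinearMap
        (TensorProduct.map (1 : H →L[ℂ] H).toLinearMap T.toLinearMap x) := by
    rw [← LinearMap.comp_apply, ← TensorProduct.map_comp]
    rfl
  rw [h, mul_assoc]
  refine (norm_map_left_le S _).trans (mul_le_mul_of_nonneg_left ?_ (norm_nonneg S))
  rw [norm_map_comm]
  simpa using norm_map_left_le T (TensorProduct.comm ℂ H K x)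

/-- The operator `S ⊗ T` on the Hilbert space `H ⊗ K`. -/
def tensorOp (S : H →L[ℂ] H) (T : K →L[ℂ] K) : HilbertTensor H K →L[ℂ] HilbertTensor H K :=
  show UniformSpace.Completion (H ⊗[ℂ] K) →L[ℂ] UniformSpace.Completion (H ⊗[ℂ] K) from
  ((TensorProduct.map S.toLinearMap T.toLinearMap).mkContinuous (‖S‖ * ‖T‖)
    (norm_map_le S T)).completion

theorem tensorOp_incl (S : H →L[ℂ] H) (T : K →L[ℂ] K) (x : H ⊗[ℂ] K) :
    tensorOp S T (HilbertTensor.incl H K x) =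
      HilbertTensor.incl H K (TensorProduct.map S.toLinearMap T.toLinearMap x) :=
  ContinuousLinearMap.completion_apply_coe
    ((TensorProduct.map S.toLinearMap T.toLinearMap).mkContinuous (‖S‖ * ‖T‖)
      (norm_map_le S T)) x

theorem hilbertTensor_ext {f g : HilbertTensor H K →L[ℂ] HilbertTensor H K}
    (h : ∀ (a : H) (b : K), f (HilbertTensor.incl H K (a ⊗ₜ[ℂ] b)) =
      g (HilbertTensor.incl H K (a ⊗ₜ[ℂ] b))) : f = g := by
  ext x
  refine isClosed_property (HilbertTensor.denseRange_incl H K)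
    (isClosed_eq f.continuous g.continuous) (fun x => ?_) x
  induction x with
  | zero => simp
  | tmul a b => exact h a b
  | add x y hx hy => rw [map_add, map_add, map_add, hx, hy]

theorem norm_tensorOp_le (S : H →L[ℂ] H) (T : K →L[ℂ] K) : ‖tensorOp S T‖ ≤ ‖S‖ * ‖T‖ := by
  refine ContinuousLinearMap.opNorm_le_bound _ (by positivity) fun x => ?_
  refine isClosed_property (p := fun x => ‖tensorOp S T x‖ ≤ ‖S‖ * ‖T‖ * ‖x‖)
    (HilbertTensor.denseRange_incl H K) (isClosed_le (by fun_prop) (by fun_prop)) (fun x => ?_) x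
  rw [tensorOp_incl, LinearIsometry.norm_map, LinearIsometry.norm_map]
  exact norm_map_le S T x

theorem star_tensorOp (S : H →L[ℂ] H) (T : K →L[ℂ] K) :
    star (tensorOp S T) = tensorOp (star S) (star T) := by
  symm
  rw [ContinuousLinearMap.star_eq_adjoint (tensorOp S T)]
  refine (ContinuousLinearMap.eq_adjoint_iff _ _).mpr fun x y => ?_
  refine isClosed_property2 (p := fun x y => inner ℂ (tensorOp (star S) (star T) x) y =
      inner ℂ x (tensorOp S T y))
    (HilbertTensor.denseRange_incl H K) (isClosed_eq (by fun_prop) (by fun_prop))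
    (fun x y => ?_) x y
  rw [tensorOp_incl, tensorOp_incl, LinearIsometry.inner_map_map, LinearIsometry.inner_map_map]
  exact inner_map_adjoint S T x y

end Operators

section Representations

variable {A B : Type*} [CStarAlgebra A] [CStarAlgebra B]
variable {H K : Type*} [NormedAddCommGroup H] [InnerProductSpace ℂ H] [CompleteSpace H]
  [NormedAddCommGroup K] [InnerProductSpace ℂ K] [CompleteSpace K]

/-- The representation `π ⊗ ρ` of the algebraic tensor product `A ⊗ B` on the Hilbert space
`H ⊗ K`, `(π ⊗ ρ)(a ⊗ b) = π(a) ⊗ ρ(b)`. -/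
def tensorRep (π : A →⋆ₐ[ℂ] (H →L[ℂ] H)) (ρ : B →⋆ₐ[ℂ] (K →L[ℂ] K)) :
    A ⊗[ℂ] B →⋆ₐ[ℂ] (HilbertTensor H K →L[ℂ] HilbertTensor H K) :=
  let f : A ⊗[ℂ] B →ₐ[ℂ] (HilbertTensor H K →L[ℂ] HilbertTensor H K) :=
    Algebra.TensorProduct.algHomOfLinearMapTensorProduct
      (TensorProduct.lift (LinearMap.mk₂ ℂ (fun a b => tensorOp (π a) (ρ b))
        (fun a₁ a₂ b => hilbertTensor_ext fun h k => by
          simp [tensorOp_incl, TensorProduct.add_tmul])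
        (fun c a b => hilbertTensor_ext fun h k => by
          simp [tensorOp_incl, ← TensorProduct.smul_tmul'])
        (fun a b₁ b₂ => hilbertTensor_ext fun h k => by
          simp [tensorOp_incl, TensorProduct.tmul_add])
        (fun c a b => hilbertTensor_ext fun h k => by
          simp [tensorOp_incl])))
      (fun a₁ a₂ b₁ b₂ => hilbertTensor_ext fun h k => by simp [tensorOp_incl])
      (hilbertTensor_ext fun h k => by simp [tensorOp_incl])
  { f with
    map_star' := fun x => by
      change f (star x) = star (f x)
      induction x with
      | zero => simp
      | add x y hx hy => rw [star_add, map_add, map_add, star_add, hx, hy]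
      | tmul a b =>
        rw [TensorProduct.star_tmul]
        change tensorOp (π (star a)) (ρ (star b)) = star (tensorOp (π a) (ρ b))
        rw [map_star, map_star, star_tensorOp] }

theorem tensorRep_tmul (π : A →⋆ₐ[ℂ] (H →L[ℂ] H)) (ρ : B →⋆ₐ[ℂ] (K →L[ℂ] K)) (a : A) (b : B) :
    tensorRep π ρ (a ⊗ₜ[ℂ] b) = tensorOp (π a) (ρ b) := rfl

end Representations

/-- A unital representation of a unital C*-algebra on a Hilbert space. -/
structure HilbertRep.{w', u'} (A : Type u') [CStarAlgebra A] : Type (max u' (w' + 1)) where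
  H : Type w'
  [normed : NormedAddCommGroup H]
  [inner : InnerProductSpace ℂ H]
  [complete : CompleteSpace H]
  π : A →⋆ₐ[ℂ] (H →L[ℂ] H)

attribute [instance] HilbertRep.normed HilbertRep.inner HilbertRep.complete

/-- The pull-back of a representation along a *-homomorphism. -/
def HilbertRep.comap {A B : Type*} [CStarAlgebra A] [CStarAlgebra B] (P : HilbertRep.{w} B)
    (f : A →⋆ₐ[ℂ] B) : HilbertRep.{w} A where
  H := P.H
  π := P.π.comp f

section

variable (A B : Type*) [CStarAlgebra A] [CStarAlgebra B]

/-- The algebraic tensor product represented through a pair of representations. -/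
def pairRep (i : HilbertRep.{w} A × HilbertRep.{w} B) :
    A ⊗[ℂ] B →⋆ₐ[ℂ] (HilbertTensor i.1.H i.2.H →L[ℂ] HilbertTensor i.1.H i.2.H) :=
  tensorRep i.1.π i.2.π

theorem bddAbove_pairRep (x : A ⊗[ℂ] B) :
    BddAbove (Set.range fun i => ‖pairRep.{w} A B i x‖) := by
  suffices h : ∃ C : ℝ, ∀ i, ‖pairRep.{w} A B i x‖ ≤ C by
    obtain ⟨C, hC⟩ := h
    exact ⟨C, by rintro _ ⟨i, rfl⟩; exact hC i⟩
  induction x with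
  | zero => exact ⟨0, fun i => by simp⟩
  | add x y hx hy =>
    obtain ⟨C, hC⟩ := hx
    obtain ⟨D, hD⟩ := hy
    exact ⟨C + D, fun i => by
      rw [map_add]
      exact (norm_add_le _ _).trans (add_le_add (hC i) (hD i))⟩
  | tmul a b =>
    refine ⟨‖a‖ * ‖b‖, fun i => (norm_tensorOp_le _ _).trans ?_⟩
    exact mul_le_mul (NonUnitalStarAlgHom.norm_apply_le i.1.π a)
      (NonUnitalStarAlgHom.norm_apply_le i.2.π b) (norm_nonneg _) (norm_nonneg _)

/-- The spatial norm `‖x‖ = sup ‖(π ⊗ ρ)(x)‖` over all representations `π` of `A` and `ρ` of `B` on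
Hilbert spaces (in a universe containing `A` and `B`). -/
def spatialSeminorm : CStarSeminorm (A ⊗[ℂ] B) :=
  CStarSeminorm.ofFamily (pairRep.{w} A B) (bddAbove_pairRep.{w} A B)

end

/-- The spatial tensor product of the C*-algebras `A` and `B`. -/
def SpatialTensor.{w', u', v'} (A : Type u') (B : Type v') [CStarAlgebra A] [CStarAlgebra B] :
    Type (max u' v') :=
  (spatialSeminorm.{w'} A B).Completion

namespace SpatialTensor

variable {A B C D : Type*} [CStarAlgebra A] [CStarAlgebra B] [CStarAlgebra C] [CStarAlgebra D]

instance : CStarAlgebra (SpatialTensor.{w} A B) :=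
  inferInstanceAs (CStarAlgebra (spatialSeminorm.{w} A B).Completion)

/-- The canonical map of the algebraic tensor product into the spatial one. -/
def incl : A ⊗[ℂ] B →⋆ₐ[ℂ] SpatialTensor.{w} A B := (spatialSeminorm.{w} A B).ι

/-- The elementary tensor `a ⊗ b`. -/
def tmul (a : A) (b : B) : SpatialTensor.{w} A B := incl (a ⊗ₜ[ℂ] b)

theorem norm_incl (x : A ⊗[ℂ] B) :
    ‖(incl x : SpatialTensor.{w} A B)‖ = ⨆ i, ‖pairRep.{w} A B i x‖ :=
  (spatialSeminorm.{w} A B).norm_coe x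

theorem denseRange_incl : DenseRange (incl : A ⊗[ℂ] B → SpatialTensor.{w} A B) :=
  (spatialSeminorm.{w} A B).denseRange_coe

/-- The tensor product of two *-homomorphisms between the algebraic tensor products. -/
def algMap (f : A →⋆ₐ[ℂ] C) (g : B →⋆ₐ[ℂ] D) : A ⊗[ℂ] B →⋆ₐ[ℂ] C ⊗[ℂ] D :=
  { Algebra.TensorProduct.map f.toAlgHom g.toAlgHom with
    map_star' := fun x => by
      change Algebra.TensorProduct.map f.toAlgHom g.toAlgHom (star x) =
        star (Algebra.TensorProduct.map f.toAlgHom g.toAlgHom x)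
      induction x with
      | zero => simp
      | add x y hx hy => rw [star_add, map_add, map_add, star_add, hx, hy]
      | tmul a b => simp [TensorProduct.star_tmul, map_star] }

theorem algMap_tmul (f : A →⋆ₐ[ℂ] C) (g : B →⋆ₐ[ℂ] D) (a : A) (b : B) :
    algMap f g (a ⊗ₜ[ℂ] b) = f a ⊗ₜ[ℂ] g b := rfl

theorem tensorRep_algMap {H K : Type*} [NormedAddCommGroup H] [InnerProductSpace ℂ H]
    [CompleteSpace H] [NormedAddCommGroup K] [InnerProductSpace ℂ K] [CompleteSpace K]
    (π : C →⋆ₐ[ℂ] (H →L[ℂ] H)) (ρ : D →⋆ₐ[ℂ] (K →L[ℂ] K))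
    (f : A →⋆ₐ[ℂ] C) (g : B →⋆ₐ[ℂ] D) (x : A ⊗[ℂ] B) :
    tensorRep π ρ (algMap f g x) = tensorRep (π.comp f) (ρ.comp g) x := by
  induction x with
  | zero => simp only [map_zero]
  | add x y hx hy => simp only [map_add, hx, hy]
  | tmul a b => rfl

theorem norm_incl_algMap_le (f : A →⋆ₐ[ℂ] C) (g : B →⋆ₐ[ℂ] D) (x : A ⊗[ℂ] B) :
    ‖(incl (algMap f g x) : SpatialTensor.{w} C D)‖ ≤ (spatialSeminorm.{w} A B).toFun x := by
  rw [norm_incl]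
  refine Real.iSup_le (fun i => ?_) (Real.iSup_nonneg fun _ => norm_nonneg _)
  have h := le_ciSup (bddAbove_pairRep.{w} A B x) (i.1.comap f, i.2.comap g)
  exact (congrArg norm (tensorRep_algMap i.1.π i.2.π f g x)).trans_le h

/-- The *-homomorphism `f ⊗ g` between spatial tensor products. -/
def map (f : A →⋆ₐ[ℂ] C) (g : B →⋆ₐ[ℂ] D) : SpatialTensor.{w} A B →⋆ₐ[ℂ] SpatialTensor.{w} C D :=
  (spatialSeminorm.{w} A B).lift (incl.comp (algMap f g)) (norm_incl_algMap_le f g)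

theorem map_incl (f : A →⋆ₐ[ℂ] C) (g : B →⋆ₐ[ℂ] D) (x : A ⊗[ℂ] B) :
    map f g (incl x : SpatialTensor.{w} A B) = incl (algMap f g x) :=
  (spatialSeminorm.{w} A B).lift_ι _ _ x

/-- The canonical identification `(A ⊗ B) ⊗ C = A ⊗ (B ⊗ C)` of triple spatial tensor products, as a
relation: it is the closure of the graph of the identification `(a ⊗ b) ⊗ c ↔ a ⊗ (b ⊗ c)` of the
algebraic triple tensor products, which is isometric for the spatial norms. -/
def AssocRel (x : SpatialTensor.{w} (SpatialTensor.{w} A B) C)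
    (y : SpatialTensor.{w} A (SpatialTensor.{w} B C)) : Prop :=
  (x, y) ∈ closure (Set.range fun t : (A ⊗[ℂ] B) ⊗[ℂ] C =>
    ((incl (Algebra.TensorProduct.map (incl : A ⊗[ℂ] B →⋆ₐ[ℂ] SpatialTensor.{w} A B).toAlgHom
        (AlgHom.id ℂ C) t) : SpatialTensor.{w} (SpatialTensor.{w} A B) C),
      (incl (Algebra.TensorProduct.map (AlgHom.id ℂ A)
        (incl : B ⊗[ℂ] C →⋆ₐ[ℂ] SpatialTensor.{w} B C).toAlgHom
        (TensorProduct.assoc ℂ A B C t)) : SpatialTensor.{w} A (SpatialTensor.{w} B C))))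

end SpatialTensor

end SpatialTensor

/-! ### Compact quantum groups and their actions -/

/-- A compact quantum group with algebra of continuous functions `A`: a coassociative unital
*-homomorphism `Δ : A → A ⊗ A` (`(Δ ⊗ id) Δ = (id ⊗ Δ) Δ`) satisfying the quantum cancellation
rules. -/
structure CompactQuantumGroup (A : Type u) [CStarAlgebra A] where
  Δ : A →⋆ₐ[ℂ] SpatialTensor.{u} A A
  coassoc : ∀ a, SpatialTensor.AssocRel
    (SpatialTensor.map.{u} Δ (StarAlgHom.id ℂ A) (Δ a))
    (SpatialTensor.map.{u} (StarAlgHom.id ℂ A) Δ (Δ a))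
  cancel_left : Dense (Submodule.span ℂ
    {x | ∃ a b, x = Δ a * SpatialTensor.tmul 1 b} : Set (SpatialTensor.{u} A A))
  cancel_right : Dense (Submodule.span ℂ
    {x | ∃ a b, x = Δ a * SpatialTensor.tmul b 1} : Set (SpatialTensor.{u} A A))

namespace CompactQuantumGroup

variable {A : Type u} [CStarAlgebra A] (G : CompactQuantumGroup A)

/-- `U` is a fundamental unitary representation: it is a unitary matrix over `A` with
`Δ(U i j) = ∑ k, U i k ⊗ U k j`, whose entries generate `A` as a C*-algebra. -/
structure IsFundamentalRep {ι : Type*} [Fintype ι] [DecidableEq ι] (U : Matrix ι ι A) : Prop where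
  unitary : U ∈ unitary (Matrix ι ι A)
  comul : ∀ i j, G.Δ (U i j) = ∑ k, SpatialTensor.tmul (U i k) (U k j)
  generates : Dense (StarAlgebra.adjoin ℂ {a | ∃ i j, a = U i j} : Set A)

/-- `α : B → B ⊗ A` is an action of the compact quantum group `G` on the C*-algebra `B`:
`(α ⊗ id) α = (id ⊗ Δ) α`, and the span of `α(B) (1 ⊗ A)` is dense in `B ⊗ A`. -/
structure IsAction {B : Type} [CStarAlgebra B] (α : B →⋆ₐ[ℂ] SpatialTensor.{u} B A) : Prop where
  coassoc : ∀ b, SpatialTensor.AssocRel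
    (SpatialTensor.map.{u} α (StarAlgHom.id ℂ A) (α b))
    (SpatialTensor.map.{u} (StarAlgHom.id ℂ B) G.Δ (α b))
  dense : Dense (Submodule.span ℂ
    {x | ∃ b a, x = α b * SpatialTensor.tmul 1 a} : Set (SpatialTensor.{u} B A))

end CompactQuantumGroup

/-! ### Group C*-algebras -/

namespace GroupAlgebra

variable {Γ : Type*} [Group Γ]

/-- The involution `(∑ c_γ γ)* = ∑ conj(c_γ) γ⁻¹` of the group algebra. -/
instance : Star (MonoidAlgebra ℂ Γ) :=
  ⟨fun x => x.coeff.sum fun γ c => MonoidAlgebra.single γ⁻¹ (star c)⟩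

theorem star_def (x : MonoidAlgebra ℂ Γ) :
    star x = x.coeff.sum fun γ c => MonoidAlgebra.single γ⁻¹ (star c) := rfl

theorem star_single (γ : Γ) (c : ℂ) :
    star (MonoidAlgebra.single γ c) = MonoidAlgebra.single γ⁻¹ (star c) := by
  rw [star_def, MonoidAlgebra.coeff_single, Finsupp.sum_single_index]
  simp

theorem star_add' (x y : MonoidAlgebra ℂ Γ) : star (x + y) = star x + star y := by
  simp only [star_def, MonoidAlgebra.coeff_add]
  exact Finsupp.sum_add_index' (by simp) (by simp [MonoidAlgebra.single_add])

theorem star_zero' : star (0 : MonoidAlgebra ℂ Γ) = 0 := by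
  simp [star_def]

instance : StarRing (MonoidAlgebra ℂ Γ) where
  star_involutive x := by
    induction x using MonoidAlgebra.induction_linear with
    | zero => simp only [star_zero']
    | add x y hx hy => simp only [star_add', hx, hy]
    | single γ c => simp only [star_single, inv_inv, star_star]
  star_mul x y := by
    induction x using MonoidAlgebra.induction_linear with
    | zero => simp only [star_zero', zero_mul, mul_zero]
    | add x₁ x₂ h₁ h₂ => simp only [add_mul, mul_add, star_add', h₁, h₂]
    | single γ c =>
      induction y using MonoidAlgebra.induction_linear with
      | zero => simp only [star_zero', zero_mul, mul_zero]
      | add y₁ y₂ h₁ h₂ => simp only [add_mul, mul_add, star_add', h₁, h₂]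
      | single δ d => simp only [MonoidAlgebra.single_mul_single, star_single, mul_inv_rev, star_mul]
  star_add := star_add'

instance : StarModule ℂ (MonoidAlgebra ℂ Γ) where
  star_smul c x := by
    induction x using MonoidAlgebra.induction_linear with
    | zero => simp only [star_zero, smul_zero]
    | add x y hx hy => simp only [smul_add, star_add, hx, hy]
    | single γ d => simp [star_single]

/-- The *-homomorphism of the group algebra given by a unitary representation. -/
def lift {D : Type*} [CStarAlgebra D] (ρ : Γ →* unitary D) : MonoidAlgebra ℂ Γ →⋆ₐ[ℂ] D :=
  { MonoidAlgebra.lift ℂ D Γ ((unitary D).subtype.comp ρ) with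
    map_star' := fun x => by
      change MonoidAlgebra.lift ℂ D Γ ((unitary D).subtype.comp ρ) (star x) =
        star (MonoidAlgebra.lift ℂ D Γ ((unitary D).subtype.comp ρ) x)
      induction x using MonoidAlgebra.induction_linear with
      | zero => simp
      | add x y hx hy => rw [star_add, map_add, map_add, star_add, hx, hy]
      | single γ c =>
        rw [star_single, MonoidAlgebra.lift_single, MonoidAlgebra.lift_single, star_smul]
        congr 1
        change ((ρ γ⁻¹ : unitary D) : D) = star (ρ γ : D)
        rw [map_inv, ← Unitary.coe_star]
        rfl }

theorem lift_single {D : Type*} [CStarAlgebra D] (ρ : Γ →* unitary D) (γ : Γ) (c : ℂ) :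
    lift ρ (MonoidAlgebra.single γ c) = c • (ρ γ : D) :=
  MonoidAlgebra.lift_single _ _ _

end GroupAlgebra

/-- A unitary representation of a group on a Hilbert space. -/
structure UnitaryRep.{w', v'} (Γ : Type v') [Group Γ] : Type (max v' (w' + 1)) where
  H : Type w'
  [normed : NormedAddCommGroup H]
  [inner : InnerProductSpace ℂ H]
  [complete : CompleteSpace H]
  ρ : Γ →* unitary (H →L[ℂ] H)

attribute [instance] UnitaryRep.normed UnitaryRep.inner UnitaryRep.complete

theorem bddAbove_unitaryRep (Γ : Type v) [Group Γ] (x : MonoidAlgebra ℂ Γ) :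
    BddAbove (Set.range fun i : UnitaryRep.{w} Γ => ‖GroupAlgebra.lift i.ρ x‖) := by
  suffices h : ∃ C : ℝ, ∀ i : UnitaryRep.{w} Γ, ‖GroupAlgebra.lift i.ρ x‖ ≤ C by
    obtain ⟨C, hC⟩ := h
    exact ⟨C, by rintro _ ⟨i, rfl⟩; exact hC i⟩
  induction x using MonoidAlgebra.induction_linear with
  | zero => exact ⟨0, fun i => by simp⟩
  | add x y hx hy =>
    obtain ⟨C, hC⟩ := hx
    obtain ⟨D, hD⟩ := hy
    exact ⟨C + D, fun i => by
      rw [map_add]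
      exact (norm_add_le _ _).trans (add_le_add (hC i) (hD i))⟩
  | single γ c =>
    refine ⟨‖c‖, fun i => ?_⟩
    rw [GroupAlgebra.lift_single, norm_smul]
    have h1 : ‖(i.ρ γ : i.H →L[ℂ] i.H)‖ * ‖(i.ρ γ : i.H →L[ℂ] i.H)‖ ≤ 1 := by
      rw [← CStarRing.norm_star_mul_self, Unitary.coe_star_mul_self]
      exact ContinuousLinearMap.norm_id_le
    exact mul_le_of_le_one_right (norm_nonneg c)
      (by nlinarith [norm_nonneg (i.ρ γ : i.H →L[ℂ] i.H)])

/-- The universal norm `‖x‖ = sup ‖ρ(x)‖` over all unitary representations `ρ` of `Γ`. -/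
def groupSeminorm (Γ : Type v) [Group Γ] : CStarSeminorm (MonoidAlgebra ℂ Γ) :=
  CStarSeminorm.ofFamily (fun i : UnitaryRep.{w} Γ => GroupAlgebra.lift i.ρ)
    (bddAbove_unitaryRep.{v, w} Γ)

/-- The (full) group C*-algebra `C*(Γ)`. The universe of the Hilbert spaces is irrelevant as long as
it contains that of `Γ`. -/
def GroupCStar.{w', v'} (Γ : Type v') [Group Γ] : Type v' := (groupSeminorm.{v', w'} Γ).Completion

namespace GroupCStar

variable {Γ : Type v} [Group Γ]

instance : CStarAlgebra (GroupCStar.{w} Γ) :=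
  inferInstanceAs (CStarAlgebra (groupSeminorm.{v, w} Γ).Completion)

/-- The canonical map of the group algebra into `C*(Γ)`. -/
def incl : MonoidAlgebra ℂ Γ →⋆ₐ[ℂ] GroupCStar.{w} Γ := (groupSeminorm.{v, w} Γ).ι

/-- The element of `C*(Γ)` given by a group element. -/
def of (γ : Γ) : GroupCStar.{w} Γ := incl (MonoidAlgebra.single γ 1)

theorem norm_incl (x : MonoidAlgebra ℂ Γ) :
    ‖(incl x : GroupCStar.{w} Γ)‖ = ⨆ i : UnitaryRep.{w} Γ, ‖GroupAlgebra.lift i.ρ x‖ :=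
  (groupSeminorm.{v, w} Γ).norm_coe x

theorem denseRange_incl : DenseRange (incl : MonoidAlgebra ℂ Γ → GroupCStar.{w} Γ) :=
  (groupSeminorm.{v, w} Γ).denseRange_coe

end GroupCStar

section Preservation

variable {Γ : Type} [Group Γ] {A : Type u} [CStarAlgebra A]

/-- The inclusion of the algebraic tensor product of the group algebra of `Γ` and `A` into the
spatial tensor product `C*(Γ) ⊗ A`. -/
def algIncl (t : MonoidAlgebra ℂ Γ ⊗[ℂ] A) : SpatialTensor.{u} (GroupCStar.{u} Γ) A :=
  SpatialTensor.incl (TensorProduct.map (GroupCStar.incl : MonoidAlgebra ℂ Γ →⋆ₐ[ℂ]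
    GroupCStar.{u} Γ).toAlgHom.toLinearMap LinearMap.id t)

/-- The linear map `f_γ` on the algebraic tensor product of the group algebra and `A`,
`f_γ(γ' ⊗ a) = δ_{γ, γ'} a`. -/
def coeffMap (γ : Γ) : MonoidAlgebra ℂ Γ ⊗[ℂ] A →ₗ[ℂ] A :=
  (TensorProduct.lid ℂ A).toLinearMap ∘ₗ TensorProduct.map
    (Finsupp.lapply γ ∘ₗ (MonoidAlgebra.coeffLinearEquiv ℂ).toLinearMap) LinearMap.id

/-- `α` preserves the function `φ` of the elements of the set `S`: for `γ ∈ S`, the element `α(γ)`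
lies in the algebraic tensor product, and `f_γ'(α(γ)) = 0` whenever `φ(γ') ≠ φ(γ)`. -/
def PreservesOn {X : Type*}
    (α : GroupCStar.{u} Γ →⋆ₐ[ℂ] SpatialTensor.{u} (GroupCStar.{u} Γ) A)
    (S : Set Γ) (φ : Γ → X) : Prop :=
  ∀ γ ∈ S, ∃ t : MonoidAlgebra ℂ Γ ⊗[ℂ] A, α (GroupCStar.of γ) = algIncl t ∧
    ∀ γ', φ γ' ≠ φ γ → coeffMap γ' t = 0

end Preservation

/-! ### Block length and shape in free groups -/

section FreeGroup

variable {n : ℕ}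

/-- The lengths `|k₁|, …, |k_m|` of the successive blocks of the element
`γ_{σ₁}^{k₁} ⋯ γ_{σ_m}^{k_m}` of the free group (`k_j ≠ 0`, `σ_j ≠ σ_{j+1}`), that is, of the
maximal runs of equal generators, up to inversion, in its reduced word. -/
def blocks (γ : FreeGroup (Fin n)) : List ℕ :=
  ((γ.toWord.map Prod.fst).splitBy (· == ·)).map List.length

/-- The block length `b(γ_{σ₁}^{k₁} ⋯ γ_{σ_m}^{k_m}) = m`. -/
def blockLength (γ : FreeGroup (Fin n)) : ℕ := (blocks γ).length

/-- The shape `(|k₁|, |k₁| + |k₂|, …, |k₁| + ⋯ + |k_m|)` of `γ_{σ₁}^{k₁} ⋯ γ_{σ_m}^{k_m}`. -/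
def shape (γ : FreeGroup (Fin n)) : List ℕ := ((blocks γ).scanl (· + ·) 0).tail

end FreeGroup

/-! ### The index set of pairs, the matrix conditions and the action -/

/-- The index set of the pairs `iκ` with `i ∈ {-1, 1}` and `κ ∈ {1, …, n}`. -/
abbrev PairIndex (n : ℕ) : Type := ℤˣ × Fin n

/-- The fixed point free involution `iκ ↦ īκ` with `ī = -i`, which exchanges the indices of the two
group elements `γ_κ` and `γ_κ⁻¹`. -/
def PairIndex.bar {n : ℕ} (x : PairIndex n) : PairIndex n := (-x.1, x.2)

/-- The element `γ_κ^i` of the free group, for `x = iκ`. -/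
def PairIndex.elt {n : ℕ} (x : PairIndex n) : FreeGroup (Fin n) := FreeGroup.of x.2 ^ (x.1 : ℤ)

/-- The defining conditions of the fundamental representation of `H⁺(n,0)`, apart from unitarity:
the entries are partial isometries, and `U_{iκ,jβ} = U_{īκ,j̄β}*`. -/
structure IsHyperoctahedral {n : ℕ} {A : Type*} [CStarAlgebra A]
    (U : Matrix (PairIndex n) (PairIndex n) A) : Prop where
  partial_isometry : ∀ x z, U x z * star (U x z) * U x z = U x z
  bar_eq : ∀ x z, U x z = star (U x.bar z.bar)

/-- `α(γ_κ) = ∑_{iσ} γ_σ^i ⊗ U_{iσ,1κ}` for all `κ`. -/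
def IsStandardFormula {n : ℕ} {A : Type u} [CStarAlgebra A]
    (U : Matrix (PairIndex n) (PairIndex n) A)
    (α : GroupCStar.{u} (FreeGroup (Fin n)) →⋆ₐ[ℂ]
      SpatialTensor.{u} (GroupCStar.{u} (FreeGroup (Fin n))) A) : Prop :=
  ∀ κ : Fin n, α (GroupCStar.of (FreeGroup.of κ)) =
    ∑ x : PairIndex n, SpatialTensor.tmul (GroupCStar.of x.elt) (U x (1, κ))

/-- The canonical basis `e_z ⊗ e_x` of `ℂ^ι ⊗ ℂ^ι`. -/
def tensorBasis (ι : Type*) [Fintype ι] [DecidableEq ι] :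
    Module.Basis (ι × ι) ℂ ((ι → ℂ) ⊗[ℂ] (ι → ℂ)) :=
  (Pi.basisFun ℂ ι).tensorProduct (Pi.basisFun ℂ ι)

/-- The intertwiner space `Hom(U^{⊗2}; U^{⊗2})`: the operators `T` with
`(T ⊗ id) U^{⊗2} = U^{⊗2} (T ⊗ id)`, where `U^{⊗2}` has the entries `U_{az} U_{bx}`. -/
def HomTensorSquare {ι : Type*} [Fintype ι] [DecidableEq ι] {A : Type*} [CStarAlgebra A]
    (U : Matrix ι ι A) : Set ((ι → ℂ) ⊗[ℂ] (ι → ℂ) →ₗ[ℂ] (ι → ℂ) ⊗[ℂ] (ι → ℂ)) :=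
  {T | (LinearMap.toMatrix (tensorBasis ι) (tensorBasis ι) T).map (algebraMap ℂ A) * (U ⊗ₖ U) =
    (U ⊗ₖ U) * (LinearMap.toMatrix (tensorBasis ι) (tensorBasis ι) T).map (algebraMap ℂ A)}

/-- The operator `T(e_z ⊗ e_x) = δ_{z, x̄} e_{z̄} ⊗ e_z`. -/
def flipOp (n : ℕ) : (PairIndex n → ℂ) ⊗[ℂ] (PairIndex n → ℂ) →ₗ[ℂ]
    (PairIndex n → ℂ) ⊗[ℂ] (PairIndex n → ℂ) :=
  (tensorBasis (PairIndex n)).constr ℂ fun p =>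
    if p.1 = p.2.bar then Pi.single p.1.bar (1 : ℂ) ⊗ₜ[ℂ] Pi.single p.1 (1 : ℂ) else 0

end

/-! All five conditions express orthogonality relations between entries of `U`. Unitarity and the
partial isometry condition make distinct entries of a row have orthogonal ranges, and distinct
entries of a column orthogonal initial spaces (`star_mul_eq_zero_of_sum_eq_one`). Since `star (U x
z) = U x.bar z.bar`, products `U x z * U y w` vanish when exactly one of `y = x.bar`, `w = z.bar`
holds. Normality is what adds the same dichotomy for `y = x` and `w = z`: it amounts to `U x z * U x
w = 0` for `z ≠ w` (`isStarNormal_of_mul_eq_zero`, `mul_eq_zero_of_normal_row`).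

In the intertwining relation for `flipOp`, the matrix entries not covered by those vanishing
products say exactly that `U x z` commutes with its adjoint.

The image under `α` of a reduced word `zs` is a sum over words `xs` of the same length, with
coefficients the products of the `U x_j z_j`. If the entries are normal, a nonzero coefficient
forces neighbouring letters of `xs` to be equal, or mutually inverse, exactly where those of `zs`
are. Thus `xs` is reduced, without cancellation, and has the same blocks, hence the same shape
(`wordImage_mem_closure`, `SamePattern.blocks_eq`). Shape determines block length. Conversely, the
coefficient of `γ_x γ_x` in `α (γ_z γ_w)` is `U x z * U x w`; preservation of block length on words
of two blocks kills it, and normality follows (`normal_of_preservesOn`).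

Coefficients must be readable from the completed tensor product, because the witness in
`PreservesOn` is arbitrary: the regular representation tensored with a separating representation of
`A` recovers them (`coeffMap_eq_of_algIncl_eq`). The action itself exists because the elements `∑ x,
γ_x ⊗ U x z` are unitary, so that freeness and the universal norm provide the homomorphism; its
action properties are checked on generators. -/

noncomputable section

/-! ### Separation by representations -/

section Separation

open scoped ComplexOrder

variable {A : Type u} [CStarAlgebra A]

attribute [local instance] CStarAlgebra.spectralOrder CStarAlgebra.spectralOrderedRing

/-- Positive functionals separate the points of a C*-algebra. -/
theorem exists_positiveLinearMap_ne_zero {a : A} (ha : a ≠ 0) :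
    ∃ f : A →ₚ[ℂ] ℂ, f (star a * a) ≠ 0 := by
  have hpos : (0 : A) ≤ star a * a := star_mul_self_nonneg a
  have hne : star a * a ≠ 0 := by simpa using ha
  have hmem : -(star a * a) ∉ {x : A | 0 ≤ x} := fun h =>
    hne (le_antisymm (by simpa using h) hpos)
  have hconv : Convex ℝ {x : A | 0 ≤ x} := fun x hx y hy s t hs ht _ =>
    add_nonneg (smul_nonneg hs (show (0 : A) ≤ x from hx))
      (smul_nonneg ht (show (0 : A) ≤ y from hy))
  -- Separate `-(star a * a)` from the closed positive cone. Because the set is a cone, the real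
  -- part of the separating functional must be nonnegative on it.
  obtain ⟨f, c, hfc, hcf⟩ := RCLike.geometric_hahn_banach_point_closed (𝕜 := ℂ)
    hconv CStarAlgebra.isClosed_nonneg hmem
  have hc : c < 0 := by simpa using hcf 0 (le_refl (0 : A))
  have hnn : ∀ x : A, 0 ≤ x → 0 ≤ (f x).re := fun x hx => by
    by_contra! hlt
    -- This rescaling stays in the cone and makes the real part equal to `c`, against the strict
    -- inequality.
    have h := hcf ((c / (f x).re) • x) (smul_nonneg (div_nonneg_of_nonpos hc.le hlt.le) hx)
    rw [← Complex.coe_smul, map_smul] at h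
    simp [hlt.ne] at h
  -- Only the real part of `f` is controlled; symmetrizing gives a complex-linear functional equal
  -- to twice that real part on positive elements.
  let g : A →ₗ[ℂ] ℂ :=
    { toFun := fun x => f x + star (f (star x))
      map_add' := fun x y => by simp only [star_add, map_add]; ring
      map_smul' := fun k x => by simp [mul_add] }
  have hg : ∀ x : A, 0 ≤ x → g x = ((2 * (f x).re : ℝ) : ℂ) := fun x hx => by
    change f x + star (f (star x)) = _
    rw [(IsSelfAdjoint.of_nonneg hx).star_eq]
    apply Complex.ext <;> simp
    ring
  refine ⟨PositiveLinearMap.mk₀ g fun x hx => ?_, ?_⟩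
  · rw [hg x hx]
    exact_mod_cast mul_nonneg zero_le_two (hnn x hx)
  · change g _ ≠ 0
    rw [hg _ hpos]
    have : (f (-(star a * a))).re < 0 := lt_trans hfc hc
    rw [map_neg, Complex.neg_re] at this
    norm_cast
    linarith

/-- Representations separate the points of a C*-algebra. -/
theorem exists_hilbertRep_ne_zero {a : A} (ha : a ≠ 0) :
    ∃ P : HilbertRep.{u} A, P.π a ≠ 0 := by
  obtain ⟨f, hf⟩ := exists_positiveLinearMap_ne_zero ha
  refine ⟨{ H := f.GNS, π := f.gnsStarAlgHom }, fun h => hf ?_⟩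
  -- Test the GNS representation on its cyclic vector: the squared norm of `π(a) 1` is `f (star a *
  -- a)`.
  have h1 : f.gnsNonUnitalStarAlgHom a (f.toPreGNS 1 : f.PreGNS) = 0 := by
    have : f.gnsNonUnitalStarAlgHom a = 0 := h
    rw [this]; rfl
  rw [PositiveLinearMap.gnsNonUnitalStarAlgHom_apply_coe] at h1
  have h2 := congrArg norm h1
  rw [UniformSpace.Completion.norm_coe, norm_zero] at h2
  have h3 := f.preGNS_norm_sq (f.leftMulMapPreGNS a (f.toPreGNS 1))
  rw [h2] at h3
  simpa using h3.symm

end Separation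

/-! ### The regular representation -/

section Regular

variable {ι : Type*} {H : Type*} [NormedAddCommGroup H] [InnerProductSpace ℂ H]

theorem HilbertBasis.clm_ext (b : HilbertBasis ι ℂ H) {f g : H →L[ℂ] H}
    (h : ∀ i, f (b i) = g (b i)) : f = g :=
  ContinuousLinearMap.ext_on (s := Set.range b)
    (Submodule.dense_iff_topologicalClosure_eq_top.mpr b.dense_span)
    (by rintro _ ⟨i, rfl⟩; exact h i)

/-- The unitary operator that permutes the vectors of a Hilbert basis. -/
theorem HilbertBasis.exists_perm [CompleteSpace H] (b : HilbertBasis ι ℂ H) (σ : Equiv.Perm ι) :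
    ∃ V : unitary (H →L[ℂ] H), ∀ i, (V : H →L[ℂ] H) (b i) = b (σ i) := by
  let b' : HilbertBasis ι ℂ H := HilbertBasis.mk (b.orthonormal.comp σ σ.injective) (by
    rw [σ.surjective.range_comp]
    exact b.dense_span.ge)
  refine ⟨Unitary.linearIsometryEquiv.symm (b.repr.trans b'.repr.symm), fun i => ?_⟩
  have h : b' i = b (σ i) := by
    rw [HilbertBasis.coe_mk]; rfl
  classical
  rw [← h]
  change b'.repr.symm (b.repr (b i)) = b' i
  rw [b.repr_self, b'.repr_symm_single]

/-- The regular representation of a group, on a Hilbert space of any universe. -/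
theorem exists_regularRep (Γ : Type) [Group Γ] :
    ∃ (R : UnitaryRep.{u} Γ) (e : Γ → R.H), Orthonormal ℂ e ∧
      ∀ γ δ, (R.ρ γ : R.H →L[ℂ] R.H) (e δ) = e (γ * δ) := by
  -- Lifting the index set places `ℓ²(Γ)` in the universe of the representations that define the
  -- norms.
  let b : HilbertBasis (ULift.{u} Γ) ℂ (lp (fun _ : ULift.{u} Γ => ℂ) 2) :=
    HilbertBasis.ofRepr (LinearIsometryEquiv.refl ℂ _)
  choose V hV using fun γ : Γ => b.exists_perm
    ((Equiv.ulift.trans (Equiv.mulLeft γ)).trans Equiv.ulift.symm)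
  have hV' : ∀ γ δ : Γ, (V γ : _ →L[ℂ] _) (b ⟨δ⟩) = b ⟨γ * δ⟩ := fun γ δ => hV γ ⟨δ⟩
  refine ⟨{ H := lp (fun _ : ULift.{u} Γ => ℂ) 2
            ρ := MonoidHom.mk' V fun γ δ => Subtype.ext (b.clm_ext fun ⟨η⟩ => ?_) },
    fun γ => b ⟨γ⟩, b.orthonormal.comp _ fun _ _ h => congrArg ULift.down h, hV'⟩
  rw [hV', MulMemClass.coe_mul, mul_apply_eq_comp, hV', hV', mul_assoc]

end Regular

/-! ### Extension of *-homomorphisms to the completions -/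

section Extension

namespace SpatialTensor

variable {A B : Type*} [CStarAlgebra A] [CStarAlgebra B]

/-- The representation of the spatial tensor product given by a pair of representations. -/
def repOfPair (i : HilbertRep.{w} A × HilbertRep.{w} B) :
    SpatialTensor.{w} A B →⋆ₐ[ℂ] (HilbertTensor i.1.H i.2.H →L[ℂ] HilbertTensor i.1.H i.2.H) :=
  (spatialSeminorm.{w} A B).lift (pairRep.{w} A B i) fun x =>
    le_ciSup (bddAbove_pairRep.{w} A B x) i

theorem repOfPair_incl (i : HilbertRep.{w} A × HilbertRep.{w} B) (x : A ⊗[ℂ] B) :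
    repOfPair i (incl x) = pairRep.{w} A B i x :=
  (spatialSeminorm.{w} A B).lift_ι _ _ x

/-- The norm is a supremum over pairs of representations on the algebraic tensor product by
definition; density carries the estimate to the completion. -/
theorem norm_le_of_repOfPair {d : SpatialTensor.{w} A B} {C : ℝ} (hC : 0 ≤ C)
    (h : ∀ i, ‖repOfPair i d‖ ≤ C) : ‖d‖ ≤ C := by
  refine le_of_forall_pos_le_add fun ε hε => ?_
  obtain ⟨x, hx⟩ := (denseRange_incl (A := A) (B := B)).exists_dist_lt d (half_pos hε)
  rw [dist_eq_norm] at hx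
  have h1 : ‖(incl x : SpatialTensor.{w} A B)‖ ≤ C + ε / 2 := by
    rw [norm_incl]
    refine Real.iSup_le (fun i => ?_) (by positivity)
    rw [← repOfPair_incl]
    calc ‖repOfPair i (incl x)‖ = ‖repOfPair i d - repOfPair i (d - incl x)‖ := by
          rw [map_sub, sub_sub_cancel]
      _ ≤ ‖repOfPair i d‖ + ‖repOfPair i (d - incl x)‖ := norm_sub_le _ _
      _ ≤ C + ε / 2 := add_le_add (h i)
          ((NonUnitalStarAlgHom.norm_apply_le (repOfPair i) _).trans hx.le)
  calc ‖d‖ = ‖(d - incl x) + incl x‖ := by rw [sub_add_cancel]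
    _ ≤ ‖d - incl x‖ + ‖(incl x : SpatialTensor.{w} A B)‖ := norm_add_le _ _
    _ ≤ C + ε := by linarith

theorem tmul_mul_tmul (a a' : A) (b b' : B) :
    (tmul a b * tmul a' b' : SpatialTensor.{w} A B) = tmul (a * a') (b * b') := by
  simp only [tmul, ← map_mul, Algebra.TensorProduct.tmul_mul_tmul]

theorem star_tmul (a : A) (b : B) :
    star (tmul a b : SpatialTensor.{w} A B) = tmul (star a) (star b) := by
  simp only [tmul, ← map_star, TensorProduct.star_tmul]

theorem tmul_one_one : (tmul 1 1 : SpatialTensor.{w} A B) = 1 := by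
  simp only [tmul, ← Algebra.TensorProduct.one_def, map_one]

theorem tmul_sum {κ : Type*} (s : Finset κ) (a : A) (b : κ → B) :
    (tmul a (∑ k ∈ s, b k) : SpatialTensor.{w} A B) = ∑ k ∈ s, tmul a (b k) := by
  simp only [tmul, TensorProduct.tmul_sum, map_sum]

theorem tmul_zero (a : A) : (tmul a (0 : B) : SpatialTensor.{w} A B) = 0 := by
  simp only [tmul, TensorProduct.tmul_zero, map_zero]

theorem norm_tmul_le (a : A) (b : B) : ‖(tmul a b : SpatialTensor.{w} A B)‖ ≤ ‖a‖ * ‖b‖ := by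
  rw [tmul, norm_incl]
  refine Real.iSup_le (fun i => ?_) (by positivity)
  exact (norm_tensorOp_le _ _).trans (mul_le_mul (NonUnitalStarAlgHom.norm_apply_le i.1.π a)
    (NonUnitalStarAlgHom.norm_apply_le i.2.π b) (norm_nonneg _) (norm_nonneg _))

theorem continuous_tmul_left (b : B) :
    Continuous fun a : A => (tmul a b : SpatialTensor.{w} A B) :=
  AddMonoidHomClass.continuous_of_bound
    ((incl.toAlgHom.toLinearMap ∘ₗ (TensorProduct.mk ℂ A B).flip b :
      A →ₗ[ℂ] SpatialTensor.{w} A B)) ‖b‖ fun a => by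
    rw [mul_comm]; exact norm_tmul_le a b

end SpatialTensor

namespace GroupCStar

variable {Γ : Type v} [Group Γ]

theorem of_mul (γ δ : Γ) : (of (γ * δ) : GroupCStar.{w} Γ) = of γ * of δ := by
  simp only [of, ← map_mul, MonoidAlgebra.single_mul_single, one_mul]

theorem of_one : (of 1 : GroupCStar.{w} Γ) = 1 :=
  map_one (incl : MonoidAlgebra ℂ Γ →⋆ₐ[ℂ] GroupCStar.{w} Γ)

theorem star_of (γ : Γ) : star (of γ : GroupCStar.{w} Γ) = of γ⁻¹ := by
  simp only [of, ← map_star, GroupAlgebra.star_single, star_one]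

theorem dense_span_of : Dense (Submodule.span ℂ (Set.range (of : Γ → GroupCStar.{w} Γ)) :
    Set (GroupCStar.{w} Γ)) := by
  refine (denseRange_incl (Γ := Γ)).mono ?_
  rintro _ ⟨x, rfl⟩
  induction x using MonoidAlgebra.induction_linear with
  | zero => rw [map_zero]; exact Submodule.zero_mem _
  | add x y hx hy => rw [map_add]; exact Submodule.add_mem _ hx hy
  | single γ c =>
    have : (MonoidAlgebra.single γ c : MonoidAlgebra ℂ Γ) = c • MonoidAlgebra.single γ 1 := by
      simp
    rw [this, map_smul]
    exact Submodule.smul_mem _ _ (Submodule.subset_span ⟨γ, rfl⟩)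

/-- The representation of `C*(Γ)` given by a unitary representation of `Γ`. -/
def rep (R : UnitaryRep.{w} Γ) : GroupCStar.{w} Γ →⋆ₐ[ℂ] (R.H →L[ℂ] R.H) :=
  (groupSeminorm.{v, w} Γ).lift (GroupAlgebra.lift R.ρ) fun x =>
    le_ciSup (bddAbove_unitaryRep.{v, w} Γ x) R

theorem rep_incl (R : UnitaryRep.{w} Γ) (x : MonoidAlgebra ℂ Γ) :
    rep R (incl x) = GroupAlgebra.lift R.ρ x :=
  (groupSeminorm.{v, w} Γ).lift_ι _ _ x

theorem rep_of (R : UnitaryRep.{w} Γ) (γ : Γ) : rep R (of γ) = R.ρ γ := by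
  rw [of, rep_incl, GroupAlgebra.lift_single, one_smul]

/-- Unitary representations of `Γ` in a spatial tensor product extend to `C*(Γ)`. -/
theorem exists_lift {A B : Type*} [CStarAlgebra A] [CStarAlgebra B]
    (ρ : Γ →* unitary (SpatialTensor.{w} A B)) :
    ∃ f : GroupCStar.{w} Γ →⋆ₐ[ℂ] SpatialTensor.{w} A B, ∀ γ, f (of γ) = ρ γ := by
  have hb : ∀ x, ‖GroupAlgebra.lift ρ x‖ ≤ (groupSeminorm.{v, w} Γ).toFun x := fun x => by
    -- The universal norm only tests representations on Hilbert spaces, so `ρ` is composed with each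
    -- `repOfPair i`; these composites suffice to bound the spatial norm.
    refine SpatialTensor.norm_le_of_repOfPair (Real.iSup_nonneg fun _ => norm_nonneg _) fun i => ?_
    let R : UnitaryRep.{w} Γ :=
      { H := HilbertTensor i.1.H i.2.H
        ρ := MonoidHom.mk' (fun γ => ⟨SpatialTensor.repOfPair i (ρ γ),
          Unitary.map_mem (SpatialTensor.repOfPair i) (ρ γ).2⟩)
          fun γ δ => Subtype.ext (by simp) }
    have hR : SpatialTensor.repOfPair i (GroupAlgebra.lift ρ x) = GroupAlgebra.lift R.ρ x := by
      induction x using MonoidAlgebra.induction_linear with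
      | zero => simp only [map_zero]
      | add x y hx hy => simp only [map_add, hx, hy]
      | single γ c => rw [GroupAlgebra.lift_single, GroupAlgebra.lift_single, map_smul]; rfl
    rw [hR]
    exact le_ciSup (bddAbove_unitaryRep.{v, w} Γ x) R
  refine ⟨(groupSeminorm.{v, w} Γ).lift (GroupAlgebra.lift ρ) hb, fun γ => ?_⟩
  have h := (groupSeminorm.{v, w} Γ).lift_ι (GroupAlgebra.lift ρ) hb (MonoidAlgebra.single γ 1)
  rw [GroupAlgebra.lift_single, one_smul] at h
  exact h

end GroupCStar

end Extension

/-! ### Coefficients of elements of the algebraic tensor product -/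

section Coefficients

variable {Γ : Type} [Group Γ] {A : Type u} [CStarAlgebra A]

theorem coeffMap_single_tmul [DecidableEq Γ] (γ γ' : Γ) (c : ℂ) (a : A) :
    coeffMap γ (MonoidAlgebra.single γ' c ⊗ₜ[ℂ] a) = if γ' = γ then c • a else 0 := by
  simp only [coeffMap, LinearMap.comp_apply, TensorProduct.map_tmul, LinearEquiv.coe_coe,
    TensorProduct.lid_tmul, LinearMap.id_apply, Finsupp.lapply_apply,
    MonoidAlgebra.coeffLinearEquiv_apply, MonoidAlgebra.coeff_single, Finsupp.single_apply]
  split_ifs <;> simp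

theorem algIncl_eq (t : MonoidAlgebra ℂ Γ ⊗[ℂ] A) :
    algIncl t = (SpatialTensor.incl.toAlgHom.comp (Algebra.TensorProduct.map
      (GroupCStar.incl : MonoidAlgebra ℂ Γ →⋆ₐ[ℂ] GroupCStar.{u} Γ).toAlgHom
      (AlgHom.id ℂ A))) t := rfl

theorem algIncl_mul (s t : MonoidAlgebra ℂ Γ ⊗[ℂ] A) :
    algIncl (s * t) = algIncl s * algIncl t := by
  simp only [algIncl_eq, map_mul]

theorem algIncl_one : algIncl (1 : MonoidAlgebra ℂ Γ ⊗[ℂ] A) = 1 := by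
  simp only [algIncl_eq, map_one]

theorem algIncl_single (γ : Γ) (a : A) :
    algIncl (MonoidAlgebra.single γ 1 ⊗ₜ[ℂ] a) = SpatialTensor.tmul (GroupCStar.of γ) a := rfl

theorem algIncl_add (s t : MonoidAlgebra ℂ Γ ⊗[ℂ] A) :
    algIncl (s + t) = algIncl s + algIncl t := by
  simp only [algIncl_eq, map_add]

/-- In the regular representation `γ'` moves `e 1` to `e γ'`, so pairing with `e γ` isolates the
coefficient at `γ`. -/
theorem inner_repOfPair_algIncl (R : UnitaryRep.{u} Γ) {e : Γ → R.H} (he : Orthonormal ℂ e)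
    (hR : ∀ γ δ, (R.ρ γ : R.H →L[ℂ] R.H) (e δ) = e (γ * δ)) (P : HilbertRep.{u} A)
    (t : MonoidAlgebra ℂ Γ ⊗[ℂ] A) (γ : Γ) (k k' : P.H) :
    inner ℂ (HilbertTensor.incl R.H P.H (e γ ⊗ₜ[ℂ] k'))
      (SpatialTensor.repOfPair ({ H := R.H, π := GroupCStar.rep R }, P) (algIncl t)
        (HilbertTensor.incl R.H P.H (e 1 ⊗ₜ[ℂ] k))) = inner ℂ k' (P.π (coeffMap γ t) k) := by
  classical
  induction t with
  | zero => simp [algIncl_eq]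
  | add s t hs ht =>
    simp only [algIncl_add, map_add, add_apply, inner_add_right, hs, ht]
  | tmul x a =>
    induction x using MonoidAlgebra.induction_linear with
    | zero => simp [algIncl_eq]
    | add x y hx hy =>
      simp only [TensorProduct.add_tmul, algIncl_add, map_add, add_apply,
        inner_add_right, hx, hy]
    | single δ c =>
      have h1 : (MonoidAlgebra.single δ c : MonoidAlgebra ℂ Γ) ⊗ₜ[ℂ] a =
          MonoidAlgebra.single δ 1 ⊗ₜ[ℂ] (c • a) := by
        rw [← TensorProduct.smul_tmul]; simp
      rw [h1, algIncl_single, coeffMap_single_tmul, SpatialTensor.tmul,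
        SpatialTensor.repOfPair_incl, pairRep, tensorRep_tmul, tensorOp_incl,
        LinearIsometry.inner_map_map, TensorProduct.map_tmul]
      simp only [ContinuousLinearMap.coe_coe, GroupCStar.rep_of, hR, mul_one,
        TensorProduct.inner_tmul, orthonormal_iff_ite.mp he, one_smul]
      by_cases h : δ = γ
      · simpa [h] using inner_smul_right k' (P.π a k) c
      · simp [h, Ne.symm h]

/-- This makes the choice of algebraic representative in `PreservesOn` immaterial. If two
coefficients differed, some representation of `A` would detect it, and the previous matrix
coefficients depend only on the image in the completion. -/
theorem coeffMap_eq_of_algIncl_eq {s t : MonoidAlgebra ℂ Γ ⊗[ℂ] A} (h : algIncl s = algIncl t)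
    (γ : Γ) : coeffMap γ s = coeffMap γ t := by
  by_contra hne
  obtain ⟨P, hP⟩ := exists_hilbertRep_ne_zero (sub_ne_zero.mpr hne)
  obtain ⟨R, e, he, hR⟩ := exists_regularRep.{u} Γ
  refine hP (ContinuousLinearMap.ext fun k => ext_inner_left ℂ fun k' => ?_)
  rw [map_sub, sub_apply, inner_sub_right,
    ← inner_repOfPair_algIncl R he hR, ← inner_repOfPair_algIncl R he hR, h, sub_self]
  simp

end Coefficients

/-! ### Relations between the entries -/

section Relations

attribute [local instance] CStarAlgebra.spectralOrder CStarAlgebra.spectralOrderedRing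

/-- Partial isometries whose range projections sum to `1` have orthogonal ranges. -/
theorem star_mul_eq_zero_of_sum_eq_one {ι : Type*} [Fintype ι] {A : Type*} [CStarAlgebra A]
    {v : ι → A} (hv : ∀ i, v i * star (v i) * v i = v i) (hs : ∑ i, v i * star (v i) = 1)
    {i j : ι} (hij : i ≠ j) : star (v i) * v j = 0 := by
  have hv' : ∀ i, star (v i) * (v i * star (v i)) = star (v i) := fun i => by
    simpa [mul_assoc] using congrArg star (hv i)
  -- The term `k = j` already equals the right-hand side, so the remaining positive terms sum to
  -- zero and each of them vanishes.
  have h1 : ∑ k, star (star (v k) * v j) * (star (v k) * v j) = star (v j) * v j := by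
    calc ∑ k, star (star (v k) * v j) * (star (v k) * v j)
        = star (v j) * (∑ k, v k * star (v k)) * v j := by
          rw [Finset.mul_sum, Finset.sum_mul]
          simp only [star_mul, star_star, mul_assoc]
      _ = star (v j) * v j := by rw [hs, mul_one]
  have h2 : star (star (v j) * v j) * (star (v j) * v j) = star (v j) * v j := by
    rw [star_mul, star_star, ← mul_assoc, mul_assoc (star (v j)), hv']
  classical
  rw [← Finset.add_sum_erase _ _ (Finset.mem_univ j), h2, add_eq_left,
    Finset.sum_eq_zero_iff_of_nonneg fun k _ => star_mul_self_nonneg _] at h1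
  exact CStarRing.star_mul_self_eq_zero_iff _ |>.mp (h1 i (by simp [hij]))

end Relations

/-! ### The index set, its involution and the letters of the free group -/

namespace PairIndex

variable {n : ℕ}

@[simp]
theorem bar_bar (x : PairIndex n) : x.bar.bar = x := by simp [bar]

theorem bar_ne_self (x : PairIndex n) : x.bar ≠ x := fun h =>
  (Int.isUnit_iff.mp x.1.isUnit).elim
    (fun h1 => by have := congrArg (fun y : PairIndex n => (y.1 : ℤ)) h; simp [bar, h1] at this)
    (fun h1 => by have := congrArg (fun y : PairIndex n => (y.1 : ℤ)) h; simp [bar, h1] at this)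

theorem eq_or_eq_bar_iff {x y : PairIndex n} : x = y ∨ x = y.bar ↔ x.2 = y.2 := by
  constructor
  · rintro (rfl | rfl) <;> rfl
  · intro h
    rcases Int.units_eq_one_or x.1 with h1 | h1 <;> rcases Int.units_eq_one_or y.1 with h2 | h2 <;>
      simp [Prod.ext_iff, bar, h1, h2, h]

/-- The involution as a permutation. -/
def barEquiv (n : ℕ) : Equiv.Perm (PairIndex n) := ⟨bar, bar, bar_bar, bar_bar⟩

theorem elt_bar (x : PairIndex n) : x.bar.elt = x.elt⁻¹ := by simp [elt, bar]

theorem elt_one (κ : Fin n) : elt (1, κ) = FreeGroup.of κ := by simp [elt]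

/-- The elements `x.elt` include the inverses of the generators, so they generate the free group as
a monoid. -/
theorem elt_induction {P : FreeGroup (Fin n) → Prop} (γ : FreeGroup (Fin n)) (h1 : P 1)
    (hmul : ∀ γ δ, P γ → P δ → P (γ * δ)) (helt : ∀ x : PairIndex n, P x.elt) : P γ := by
  induction γ using FreeGroup.induction_on with
  | C1 => exact h1
  | of κ => exact elt_one κ ▸ helt (1, κ)
  | inv_of κ _ => exact elt_one κ ▸ elt_bar (1, κ) ▸ helt (bar (1, κ))
  | mul γ δ hγ hδ => exact hmul γ δ hγ hδ

end PairIndex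

open PairIndex

variable {n : ℕ}

/-! ### Orthogonality, normality and the intertwiner -/

section Entries

variable {A : Type*} [CStarAlgebra A] {U : Matrix (PairIndex n) (PairIndex n) A}

theorem sum_mul_star (hU : U ∈ unitary (Matrix (PairIndex n) (PairIndex n) A)) (x y : PairIndex n) :
    ∑ z, U x z * star (U y z) = if x = y then 1 else 0 := by
  have h0 := Unitary.mul_star_self_of_mem hU
  have h := congrFun (congrFun h0 x) y
  rwa [Matrix.mul_apply, Matrix.one_apply] at h

theorem sum_star_mul (hU : U ∈ unitary (Matrix (PairIndex n) (PairIndex n) A)) (x y : PairIndex n) :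
    ∑ z, star (U z x) * U z y = if x = y then 1 else 0 := by
  have h0 := Unitary.star_mul_self_of_mem hU
  have h := congrFun (congrFun h0 x) y
  rwa [Matrix.mul_apply, Matrix.one_apply] at h

namespace IsHyperoctahedral

variable (hH : IsHyperoctahedral U) (hU : U ∈ unitary (Matrix (PairIndex n) (PairIndex n) A))
include hH

theorem star_eq (x z : PairIndex n) : star (U x z) = U x.bar z.bar := by
  rw [hH.bar_eq x.bar z.bar, bar_bar, bar_bar]

theorem star_mul_mul (x z : PairIndex n) : U x z * (star (U x z) * U x z) = U x z := by
  rw [← mul_assoc, hH.partial_isometry]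

include hU

theorem star_mul_eq_zero {x z w : PairIndex n} (h : z ≠ w) : star (U x z) * U x w = 0 :=
  star_mul_eq_zero_of_sum_eq_one (v := U x) (hH.partial_isometry x)
    ((sum_mul_star hU x x).trans (if_pos rfl)) h

theorem mul_star_eq_zero {x y z : PairIndex n} (h : x ≠ y) : U x z * star (U y z) = 0 := by
  have h' := star_mul_eq_zero_of_sum_eq_one (v := fun x => star (U x z)) (fun x => by
    simpa [mul_assoc] using congrArg star (hH.partial_isometry x z))
    (by simpa using sum_star_mul hU z z) h
  simpa using h'

/-- The first factor is `star (U x.bar z.bar)`, so both factors come from row `x.bar` and range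
orthogonality applies. No normality is needed here, nor in the column version. -/
theorem mul_eq_zero_of_row {x z w : PairIndex n} (h : w ≠ z.bar) : U x z * U x.bar w = 0 := by
  have h' := hH.star_mul_eq_zero hU (x := x.bar) (z := z.bar) (w := w) h.symm
  rwa [hH.star_eq, bar_bar, bar_bar] at h'

theorem mul_eq_zero_of_col {x y z : PairIndex n} (h : y ≠ x.bar) : U x z * U y z.bar = 0 := by
  have h' := hH.mul_star_eq_zero hU (x := x) (y := y.bar) (z := z)
    fun e => h (by rw [e, bar_bar])
  rwa [hH.star_eq, bar_bar] at h'

/-- Unitarity gives this sum with the factors in the other order. Taking adjoints entrywise is the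
permutation of indices by the involution, which exchanges the two orders. -/
theorem sum_mul_star_col (z : PairIndex n) : ∑ x, U x z * star (U x z) = 1 := by
  rw [← (sum_star_mul hU z.bar z.bar).trans (if_pos rfl)]
  refine Fintype.sum_equiv (barEquiv n) _ _ fun x => ?_
  change _ = star (U x.bar z.bar) * U x.bar z.bar
  rw [← hH.bar_eq, hH.star_eq]

theorem sum_star_mul_row (x : PairIndex n) : ∑ z, star (U x z) * U x z = 1 := by
  rw [← (sum_mul_star hU x.bar x.bar).trans (if_pos rfl)]
  refine Fintype.sum_equiv (barEquiv n) _ _ fun z => ?_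
  change _ = U x.bar z.bar * star (U x.bar z.bar)
  rw [← hH.bar_eq, hH.star_eq]

/-- If the products of distinct entries of each row vanish, then the entries are normal. -/
theorem isStarNormal_of_mul_eq_zero (h : ∀ x z w, z ≠ w → U x z * U x w = 0)
    (x z : PairIndex n) : IsStarNormal (U x z) := by
  -- Multiplying by the row sum of range projections, or below of initial projections, leaves only
  -- the term at `z`. Hence each of the two projections of `U x z` absorbs the other, and they
  -- coincide.
  have h1 : U x z = U x z * (U x z * star (U x z)) := by
    conv_lhs => rw [← mul_one (U x z), ← (sum_mul_star hU x x).trans (if_pos rfl),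
      Finset.mul_sum]
    refine Finset.sum_eq_single z (fun w _ hw => ?_) (by simp)
    rw [← mul_assoc, h x z w hw.symm, zero_mul]
  have h2 : U x z = star (U x z) * U x z * U x z := by
    conv_lhs => rw [← one_mul (U x z), ← hH.sum_star_mul_row hU x, Finset.sum_mul]
    refine Finset.sum_eq_single z (fun w _ hw => ?_) (by simp)
    rw [mul_assoc, h x w z hw, mul_zero]
  constructor
  change star (U x z) * U x z = U x z * star (U x z)
  calc star (U x z) * U x z = star (U x z) * (U x z * (U x z * star (U x z))) := by rw [← h1]
    _ = star (U x z) * U x z * U x z * star (U x z) := by simp only [mul_assoc]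
    _ = U x z * star (U x z) := by rw [← h2]

/-- For a normal partial isometry the initial and range projections agree, so orthogonality of
ranges also separates the initial space of `U x z` from the range of `U x w`. -/
theorem mul_eq_zero_of_normal_row (hN : ∀ x z, IsStarNormal (U x z)) {x z w : PairIndex n}
    (h : z ≠ w) : U x z * U x w = 0 := by
  rw [← hH.star_mul_mul x z, (hN x z).star_comm_self.eq, mul_assoc, mul_assoc,
    hH.star_mul_eq_zero hU h, mul_zero, mul_zero]

theorem mul_eq_zero_of_normal_col (hN : ∀ x z, IsStarNormal (U x z)) {x y z : PairIndex n}
    (h : x ≠ y) : U x z * U y z = 0 := by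
  rw [← hH.partial_isometry y z, ← (hN y z).star_comm_self.eq, mul_assoc, ← mul_assoc,
    hH.mul_star_eq_zero hU h, zero_mul]

/-- For normal entries, non-vanishing products have indices of the same pattern. -/
theorem pattern_of_mul_ne_zero (hN : ∀ x z, IsStarNormal (U x z)) {x y z w : PairIndex n}
    (h : U x z * U y w ≠ 0) : (y = x ↔ w = z) ∧ (y = x.bar ↔ w = z.bar) := by
  refine ⟨⟨?_, ?_⟩, ?_, ?_⟩ <;> rintro rfl <;> by_contra hne
  · exact h (hH.mul_eq_zero_of_normal_row hU hN (Ne.symm hne))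
  · exact h (hH.mul_eq_zero_of_normal_col hU hN (Ne.symm hne))
  · exact h (hH.mul_eq_zero_of_row hU hne)
  · exact h (hH.mul_eq_zero_of_col hU hne)

/-- The operator `T` intertwines `U ⊗ U` with itself if and only if the entries are normal. -/
theorem flipOp_mem_iff : flipOp n ∈ HomTensorSquare U ↔ ∀ x z, IsStarNormal (U x z) := by
  have hT : LinearMap.toMatrix (tensorBasis (PairIndex n)) (tensorBasis (PairIndex n)) (flipOp n) =
      Matrix.of fun p q => if q.1 = q.2.bar ∧ p.1 = q.1.bar ∧ p.2 = q.1 then 1 else 0 := by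
    ext p q
    have hb : ∀ x y : PairIndex n, Pi.single x (1 : ℂ) ⊗ₜ[ℂ] Pi.single y (1 : ℂ) =
        tensorBasis (PairIndex n) (x, y) := fun x y => by
      simp [tensorBasis, Module.Basis.tensorProduct_apply]
    rw [LinearMap.toMatrix_apply, flipOp, Module.Basis.constr_basis, Matrix.of_apply, hb]
    by_cases h : q.1 = q.2.bar
    · rw [if_pos h, Module.Basis.repr_self, Finsupp.single_apply]
      simp only [h, true_and, Prod.ext_iff, eq_comm]
    · simp [h]
  have hL : ∀ a b z x, ((Matrix.of fun p q : PairIndex n × PairIndex n =>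
      if q.1 = q.2.bar ∧ p.1 = q.1.bar ∧ p.2 = q.1 then (1 : ℂ) else 0).map (algebraMap ℂ A) *
        (U ⊗ₖ U)) (a, b) (z, x) = if a = b.bar then U b z * U b.bar x else 0 := fun a b z x => by
    rw [Matrix.mul_apply, Finset.sum_eq_single (b, b.bar)]
    · by_cases h : a = b.bar <;> simp [h]
    · rintro ⟨c, d⟩ - hcd
      have : ¬ (c = d.bar ∧ a = c.bar ∧ b = c) := by
        rintro ⟨rfl, -, rfl⟩
        exact hcd (by rw [bar_bar])
      simp [this]
    · simp
  have hR : ∀ a b z x, ((U ⊗ₖ U) * (Matrix.of fun p q : PairIndex n × PairIndex n =>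
      if q.1 = q.2.bar ∧ p.1 = q.1.bar ∧ p.2 = q.1 then (1 : ℂ) else 0).map (algebraMap ℂ A))
        (a, b) (z, x) = if z = x.bar then U a z.bar * U b z else 0 := fun a b z x => by
    rw [Matrix.mul_apply, Finset.sum_eq_single (z.bar, z)]
    · by_cases h : z = x.bar <;> simp [h]
    · rintro ⟨c, d⟩ - hcd
      have : ¬ (z = x.bar ∧ c = z.bar ∧ d = z) := by
        rintro ⟨-, rfl, rfl⟩
        exact hcd rfl
      simp [this]
    · simp
  rw [HomTensorSquare, Set.mem_ofPred_eq, hT]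
  constructor
  · intro h x z
    -- At these indices neither Kronecker delta vanishes, and the entry reads `U x z * star (U x z)
    -- = star (U x z) * U x z`.
    have h' := congrFun (congrFun h (x.bar, x)) (z, z.bar)
    rw [hL, hR, if_pos rfl, if_pos (bar_bar z).symm, ← hH.star_eq] at h'
    exact ⟨h'.symm⟩
  · intro hN
    ext ⟨a, b⟩ ⟨z, x⟩
    rw [hL, hR]
    -- Normality enters only when both conditions hold. If exactly one holds, the surviving product
    -- vanishes by the row or column relation.
    by_cases h1 : a = b.bar <;> by_cases h2 : z = x.bar
    · subst h1 h2
      rw [if_pos rfl, if_pos rfl, ← hH.star_eq]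
      conv_lhs => rw [← bar_bar x, ← hH.star_eq, bar_bar]
      exact (hN b x.bar).star_comm_self.eq.symm
    · rw [if_pos h1, if_neg h2, hH.mul_eq_zero_of_row hU fun h => h2 (by rw [h, bar_bar])]
    · rw [if_neg h1, if_pos h2]
      have := hH.mul_eq_zero_of_col hU (x := a) (y := b) (z := z.bar) fun h =>
        h1 (by rw [h, bar_bar])
      rw [bar_bar] at this
      exact this.symm
    · rw [if_neg h1, if_neg h2]

end IsHyperoctahedral

end Entries

/-! ### The action -/

theorem continuous_starAlgHom {A B : Type*} [CStarAlgebra A] [CStarAlgebra B] (f : A →⋆ₐ[ℂ] B) :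
    Continuous f :=
  AddMonoidHomClass.continuous_of_bound f 1 fun a => by
    rw [one_mul]; exact NonUnitalStarAlgHom.norm_apply_le f a

/-! ### The associativity relation and elementary tensors -/

namespace SpatialTensor

variable {A B C : Type*} [CStarAlgebra A] [CStarAlgebra B] [CStarAlgebra C]

/-- The pairs related by `AssocRel` form a closed subalgebra. -/
theorem exists_subalgebra_assocRel : ∃ S : Subalgebra ℂ
      (SpatialTensor.{w} (SpatialTensor.{w} A B) C × SpatialTensor.{w} A (SpatialTensor.{w} B C)),
    IsClosed (S : Set (SpatialTensor.{w} (SpatialTensor.{w} A B) C ×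
      SpatialTensor.{w} A (SpatialTensor.{w} B C))) ∧ ∀ x y, (x, y) ∈ S ↔ AssocRel x y := by
  let Φ : (A ⊗[ℂ] B) ⊗[ℂ] C →ₐ[ℂ] SpatialTensor.{w} (SpatialTensor.{w} A B) C :=
    incl.toAlgHom.comp (Algebra.TensorProduct.map
      (incl : A ⊗[ℂ] B →⋆ₐ[ℂ] SpatialTensor.{w} A B).toAlgHom (AlgHom.id ℂ C))
  let Ψ : (A ⊗[ℂ] B) ⊗[ℂ] C →ₐ[ℂ] SpatialTensor.{w} A (SpatialTensor.{w} B C) :=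
    (incl.toAlgHom.comp (Algebra.TensorProduct.map (AlgHom.id ℂ A)
      (incl : B ⊗[ℂ] C →⋆ₐ[ℂ] SpatialTensor.{w} B C).toAlgHom)).comp
      (Algebra.TensorProduct.assoc ℂ ℂ ℂ A B C).toAlgHom
  exact ⟨(Φ.prod Ψ).range.topologicalClosure, Subalgebra.isClosed_topologicalClosure _,
    fun x y => Iff.rfl⟩

theorem assocRel_tmul (a : A) (b : B) (c : C) :
    AssocRel (tmul (tmul a b) c : SpatialTensor.{w} (SpatialTensor.{w} A B) C)
      (tmul a (tmul b c) : SpatialTensor.{w} A (SpatialTensor.{w} B C)) :=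
  subset_closure ⟨(a ⊗ₜ b) ⊗ₜ c, rfl⟩

theorem sum_tmul {κ : Type*} (s : Finset κ) (a : κ → A) (b : B) :
    (tmul (∑ k ∈ s, a k) b : SpatialTensor.{w} A B) = ∑ k ∈ s, tmul (a k) b := by
  simp only [tmul, TensorProduct.sum_tmul, map_sum]

theorem map_tmul {D : Type*} [CStarAlgebra D] (f : A →⋆ₐ[ℂ] C) (g : B →⋆ₐ[ℂ] D) (a : A) (b : B) :
    map f g (tmul a b : SpatialTensor.{w} A B) = tmul (f a) (g b) := by
  rw [tmul, map_incl, algMap_tmul, tmul]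

end SpatialTensor

section Action

open SpatialTensor GroupCStar

variable {A : Type u} [CStarAlgebra A] {U : Matrix (PairIndex n) (PairIndex n) A}

variable (U) in
/-- The element `∑ x, γ_x ⊗ U x z` of `C*(𝔽ₙ) ⊗ A`. -/
def genImage (z : PairIndex n) : SpatialTensor.{u} (GroupCStar.{u} (FreeGroup (Fin n))) A :=
  ∑ x : PairIndex n, tmul (of x.elt) (U x z)

variable (hH : IsHyperoctahedral U)
include hH

theorem star_genImage (z : PairIndex n) : star (genImage U z) = genImage U z.bar := by
  rw [genImage, genImage, star_sum]
  refine Fintype.sum_equiv (barEquiv n) _ _ fun x => ?_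
  change _ = tmul (of x.bar.elt) (U x.bar z.bar)
  rw [SpatialTensor.star_tmul, star_of, elt_bar, hH.star_eq]

variable (hU : U ∈ unitary (Matrix (PairIndex n) (PairIndex n) A))

-- In the double sum, the terms `U x z * star (U y z)` with `x ≠ y` vanish, so the group elements
-- cancel and a column sum remains.
include hU in
theorem genImage_mul_star (z : PairIndex n) : genImage U z * star (genImage U z) = 1 := by
  rw [genImage, star_sum, Finset.sum_mul_sum]
  calc _ = ∑ x, tmul (1 : GroupCStar.{u} (FreeGroup (Fin n))) (U x z * star (U x z)) :=
        Finset.sum_congr rfl fun x _ => by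
        rw [Finset.sum_eq_single x]
        · rw [SpatialTensor.star_tmul, tmul_mul_tmul, star_of, ← of_mul, mul_inv_cancel, of_one]
        · intro y _ hy
          rw [SpatialTensor.star_tmul, tmul_mul_tmul, hH.mul_star_eq_zero hU hy.symm,
            SpatialTensor.tmul_zero]
        · simp
    _ = 1 := by rw [← SpatialTensor.tmul_sum, hH.sum_mul_star_col hU, tmul_one_one]

-- The second unitarity relation is the first one at `z.bar`, because the adjoint exchanges `z` and
-- `z.bar`.
include hU in
theorem genImage_mem_unitary (z : PairIndex n) : genImage U z ∈ unitary
    (SpatialTensor.{u} (GroupCStar.{u} (FreeGroup (Fin n))) A) := by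
  refine ⟨?_, genImage_mul_star hH hU z⟩
  have h := genImage_mul_star hH hU z.bar
  rwa [← star_genImage hH, star_star] at h

variable {α : GroupCStar.{u} (FreeGroup (Fin n)) →⋆ₐ[ℂ]
  SpatialTensor.{u} (GroupCStar.{u} (FreeGroup (Fin n))) A}

theorem IsStandardFormula.apply_elt (hα : IsStandardFormula U α) (z : PairIndex n) :
    α (of z.elt) = genImage U z := by
  obtain ⟨i, κ⟩ := z
  rcases Int.units_eq_one_or i with rfl | rfl
  · rw [elt_one]; exact hα κ
  · have h : ((-1, κ) : PairIndex n) = bar (1, κ) := rfl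
    rw [h, elt_bar, ← star_of, map_star, elt_one, hα κ, ← star_genImage hH]
    rfl

omit hH in
theorem GroupCStar.mem_of_isClosed {Γ : Type v} [Group Γ] {S : Submodule ℂ (GroupCStar.{w} Γ)}
    (hS : IsClosed (S : Set (GroupCStar.{w} Γ))) (h : ∀ γ, of γ ∈ S) (b : GroupCStar.{w} Γ) :
    b ∈ S := by
  have h1 : Submodule.span ℂ (Set.range (of : Γ → GroupCStar.{w} Γ)) ≤ S :=
    Submodule.span_le.mpr (by rintro _ ⟨γ, rfl⟩; exact h γ)
  have h2 := closure_minimal h1 hS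
  rw [dense_span_of.closure_eq] at h2
  exact h2 trivial

theorem IsStandardFormula.unique (hα : IsStandardFormula U α)
    {β : GroupCStar.{u} (FreeGroup (Fin n)) →⋆ₐ[ℂ]
      SpatialTensor.{u} (GroupCStar.{u} (FreeGroup (Fin n))) A}
    (hβ : IsStandardFormula U β) : α = β := by
  have hγ : ∀ γ : FreeGroup (Fin n), α (of γ) = β (of γ) := fun γ => by
    induction γ using elt_induction with
    | h1 => rw [of_one, map_one, map_one]
    | hmul γ δ h1 h2 => rw [of_mul, map_mul, map_mul, h1, h2]
    | helt x => rw [hα.apply_elt hH, hβ.apply_elt hH]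
  refine StarAlgHom.ext fun b => ?_
  exact GroupCStar.mem_of_isClosed (S := LinearMap.eqLocus α.toAlgHom.toLinearMap
    β.toAlgHom.toLinearMap) (isClosed_eq (continuous_starAlgHom α) (continuous_starAlgHom β)) hγ b

include hU in
theorem exists_isStandardFormula : ∃ α : GroupCStar.{u} (FreeGroup (Fin n)) →⋆ₐ[ℂ]
    SpatialTensor.{u} (GroupCStar.{u} (FreeGroup (Fin n))) A, IsStandardFormula U α := by
  obtain ⟨f, hf⟩ := GroupCStar.exists_lift (FreeGroup.lift fun κ : Fin n =>
    (⟨genImage U (1, κ), genImage_mem_unitary hH hU _⟩ : unitary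
      (SpatialTensor.{u} (GroupCStar.{u} (FreeGroup (Fin n))) A)))
  refine ⟨f, fun κ => ?_⟩
  rw [hf, FreeGroup.lift_apply_of]
  rfl

variable {G : CompactQuantumGroup A} (hG : G.IsFundamentalRep U)

include hG

/-- Both sides are *-homomorphisms in `b` and the related pairs form a closed subalgebra. It
therefore suffices to treat the letters, where both sides expand to the same double sum of triple
tensors. -/
theorem IsStandardFormula.coassoc (hα : IsStandardFormula U α)
    (b : GroupCStar.{u} (FreeGroup (Fin n))) :
    AssocRel (SpatialTensor.map.{u} α (StarAlgHom.id ℂ A) (α b))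
      (SpatialTensor.map.{u} (StarAlgHom.id ℂ (GroupCStar.{u} (FreeGroup (Fin n)))) G.Δ (α b)) := by
  obtain ⟨S, hS, hSr⟩ := exists_subalgebra_assocRel.{u} (A := GroupCStar.{u} (FreeGroup (Fin n)))
    (B := A) (C := A)
  let F := (SpatialTensor.map.{u} α (StarAlgHom.id ℂ A)).comp α
  let F' := (SpatialTensor.map.{u} (StarAlgHom.id ℂ (GroupCStar.{u} (FreeGroup (Fin n)))) G.Δ).comp α
  let T := S.comap (F.toAlgHom.prod F'.toAlgHom)
  suffices h : b ∈ T.toSubmodule from (hSr _ _).mp h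
  refine GroupCStar.mem_of_isClosed
    (hS.preimage ((continuous_starAlgHom F).prodMk (continuous_starAlgHom F'))) (fun γ => ?_) b
  change of γ ∈ T
  induction γ using elt_induction with
  | h1 => rw [of_one]; exact one_mem T
  | hmul γ δ h1 h2 => rw [of_mul]; exact mul_mem h1 h2
  | helt z =>
    change (F (of z.elt), F' (of z.elt)) ∈ S
    have h1 : F (of z.elt) = ∑ x, ∑ y, tmul (tmul (of y.elt) (U y x)) (U x z) := by
      change SpatialTensor.map.{u} α (StarAlgHom.id ℂ A) (α (of z.elt)) = _
      rw [hα.apply_elt hH, genImage, map_sum]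
      refine Finset.sum_congr rfl fun x _ => ?_
      rw [map_tmul, hα.apply_elt hH, genImage, sum_tmul]
      rfl
    have h2 : F' (of z.elt) = ∑ x, ∑ y, tmul (of y.elt) (tmul (U y x) (U x z)) := by
      change SpatialTensor.map.{u} (StarAlgHom.id ℂ _) G.Δ (α (of z.elt)) = _
      rw [hα.apply_elt hH, genImage, map_sum, Finset.sum_comm]
      refine Finset.sum_congr rfl fun y _ => ?_
      rw [map_tmul, hG.comul, SpatialTensor.tmul_sum]
      rfl
    have h3 : (F (of z.elt), F' (of z.elt)) = ∑ x, ∑ y,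
        ((tmul (tmul (of y.elt) (U y x)) (U x z), tmul (of y.elt) (tmul (U y x) (U x z))) :
          SpatialTensor.{u} (SpatialTensor.{u} (GroupCStar.{u} (FreeGroup (Fin n))) A) A ×
          SpatialTensor.{u} (GroupCStar.{u} (FreeGroup (Fin n))) (SpatialTensor.{u} A A)) := by
      rw [h1, h2]
      simp only [Prod.ext_iff, Prod.fst_sum, Prod.snd_sum, and_self]
    rw [h3]
    exact sum_mem fun x _ => sum_mem fun y _ => (hSr _ _).mpr (assocRel_tmul _ _ _)

/-- The span contains every `γ ⊗ a`, by induction on `γ`, and these have dense span. -/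
theorem IsStandardFormula.dense (hα : IsStandardFormula U α) :
    Dense (Submodule.span ℂ {x | ∃ b a, x = α b * tmul 1 a} :
      Set (SpatialTensor.{u} (GroupCStar.{u} (FreeGroup (Fin n))) A)) := by
  set W := Submodule.span ℂ {x | ∃ b a, x = α b * tmul 1 a} with hW
  have hmul : ∀ b, ∀ x ∈ W, α b * x ∈ W := fun b x hx => by
    induction hx using Submodule.span_induction with
    | mem x h =>
      obtain ⟨b', a, rfl⟩ := h
      exact Submodule.subset_span ⟨b * b', a, by rw [map_mul, mul_assoc]⟩
    | zero => rw [mul_zero]; exact zero_mem W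
    | add x y _ _ hx hy => rw [mul_add]; exact add_mem hx hy
    | smul c x _ hx => rw [mul_smul_comm]; exact W.smul_mem c hx
  have hof : ∀ (γ : FreeGroup (Fin n)) (a : A), tmul (of γ) a ∈ W := fun γ => by
    induction γ using elt_induction with
    | h1 =>
      intro a
      exact Submodule.subset_span ⟨1, a, by rw [of_one, map_one, one_mul]⟩
    | hmul γ δ h1 h2 =>
      intro a
      -- Right multiplication sends `α b * (1 ⊗ a')` to `α b * (δ ⊗ a' a)`. This requires the
      -- induction hypothesis for all algebra elements, and stability of `W` under left
      -- multiplication by `α b`.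
      have h : ∀ x ∈ W, x * tmul (of δ) a ∈ W := fun x hx => by
        induction hx using Submodule.span_induction with
        | mem x h =>
          obtain ⟨b, a', rfl⟩ := h
          rw [mul_assoc, tmul_mul_tmul, one_mul]
          exact hmul b _ (h2 _)
        | zero => rw [zero_mul]; exact zero_mem W
        | add x y _ _ hx hy => rw [add_mul]; exact add_mem hx hy
        | smul c x _ hx => rw [smul_mul_assoc]; exact W.smul_mem c hx
      have := h _ (h1 1)
      rwa [tmul_mul_tmul, one_mul, ← of_mul] at this
    | helt y =>
      intro a
      -- Inversion of the formula for `α` by means of `U * star U = 1`.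
      have h : tmul (of y.elt) a = ∑ z, α (of z.elt) * tmul 1 (star (U y z) * a) := by
        calc tmul (of y.elt) a = ∑ x, tmul (of x.elt) (∑ z, U x z * star (U y z) * a) := by
              rw [Finset.sum_eq_single y]
              · rw [← Finset.sum_mul, sum_mul_star hG.unitary, if_pos rfl, one_mul]
              · intro x _ hx
                rw [← Finset.sum_mul, sum_mul_star hG.unitary, if_neg hx, zero_mul,
                  SpatialTensor.tmul_zero]
              · simp
          _ = _ := by
              simp only [SpatialTensor.tmul_sum]
              rw [Finset.sum_comm]
              refine Finset.sum_congr rfl fun z _ => ?_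
              rw [hα.apply_elt hH, genImage, Finset.sum_mul]
              simp only [tmul_mul_tmul, mul_one, mul_assoc]
      rw [h]
      exact sum_mem fun z _ => Submodule.subset_span ⟨_, _, rfl⟩
  have htmul : ∀ b a, tmul b a ∈ W.topologicalClosure := fun b a =>
    GroupCStar.mem_of_isClosed (S := W.topologicalClosure.comap
      (SpatialTensor.incl.toAlgHom.toLinearMap ∘ₗ (TensorProduct.mk ℂ _ A).flip a))
      (W.isClosed_topologicalClosure.preimage (continuous_tmul_left a))
      (fun γ => subset_closure (hof γ a)) b
  have hincl : Set.range (SpatialTensor.incl : GroupCStar.{u} (FreeGroup (Fin n)) ⊗[ℂ] A → _) ⊆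
      (W.topologicalClosure : Set (SpatialTensor.{u} (GroupCStar.{u} (FreeGroup (Fin n))) A)) := by
    rintro _ ⟨t, rfl⟩
    induction t with
    | zero => rw [map_zero]; exact zero_mem _
    | add s t hs ht => rw [map_add]; exact add_mem hs ht
    | tmul b a => exact htmul b a
  have h := SpatialTensor.denseRange_incl.mono hincl
  rwa [Submodule.topologicalClosure_coe, dense_closure] at h

theorem IsStandardFormula.isAction (hα : IsStandardFormula U α) : G.IsAction α :=
  ⟨hα.coassoc hH hG, hα.dense hH hG⟩

end Action

/-! ### Words and their blocks -/

/-- The lengths of the maximal runs of equal entries, computed from the left. -/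
theorem map_length_splitBy_cons_cons {α : Type*} [DecidableEq α] (a b : α) (l : List α) :
    ((a :: b :: l).splitBy (· == ·)).map List.length =
      if b = a then (((b :: l).splitBy (· == ·)).map List.length).modifyHead (· + 1)
      else 1 :: ((b :: l).splitBy (· == ·)).map List.length := by
  split_ifs with h
  · subst h
    obtain ⟨g, gs, hg⟩ := List.exists_cons_of_ne_nil
      (List.splitBy_ne_nil (r := (· == ·)).mpr (List.cons_ne_nil b l))
    obtain ⟨h1, h2, h3, h4⟩ := List.splitBy_eq_iff.mp hg
    obtain ⟨c, g, rfl⟩ := List.exists_cons_of_ne_nil (show g ≠ [] by rintro rfl; simp at h2)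
    obtain rfl : b = c := by simpa using congrArg List.head? h1
    -- The first run of `b :: l` begins with `b`, so the new letter lengthens it; the
    -- characterization of `splitBy` verifies this.
    have h5 : (b :: b :: l).splitBy (· == ·) = (b :: b :: g) :: gs := by
      refine List.splitBy_eq_iff.mpr ⟨?_, ?_, ?_, ?_⟩
      · simp only [List.flatten_cons, List.cons_append] at h1 ⊢
        rw [h1]
      · simpa using h2
      · intro m hm
        rcases List.mem_cons.mp hm with rfl | hm
        · exact List.isChain_cons_cons.mpr ⟨by simp, h3 _ (by simp)⟩
        · exact h3 m (by simp [hm])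
      · cases gs with
        | nil => simp
        | cons k gs =>
          rw [List.isChain_cons_cons] at h4 ⊢
          refine ⟨?_, h4.2⟩
          obtain ⟨_, hk, h⟩ := h4.1
          exact ⟨List.cons_ne_nil _ _, hk, by simpa using h⟩
    rw [h5, hg]
    rfl
  · have := List.splitBy_append_cons (r := fun x y : α => x == y) (l := [a]) (a := b) l
      (by simpa using Ne.symm h)
    rw [List.singleton_append] at this
    rw [this]
    rfl

/-- The product of the free group elements given by a list of indices. -/
def wordProd (xs : List (PairIndex n)) : FreeGroup (Fin n) := (xs.map elt).prod

namespace PairIndex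

/-- The letter `γ_κ^i`. -/
def letter (x : PairIndex n) : Fin n × Bool := (x.2, decide (x.1 = 1))

theorem mk_letter (x : PairIndex n) : FreeGroup.mk [x.letter] = x.elt := by
  obtain ⟨i, κ⟩ := x
  rcases Int.units_eq_one_or i with rfl | rfl
  · rw [elt_one]; rfl
  · simp [elt, letter, FreeGroup.of, FreeGroup.inv_mk, FreeGroup.invRev]

theorem letter_surjective : Function.Surjective (letter : PairIndex n → Fin n × Bool) := by
  rintro ⟨κ, b⟩
  cases b
  · exact ⟨(-1, κ), by simp [letter]⟩
  · exact ⟨(1, κ), by simp [letter]⟩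

theorem letter_injective : Function.Injective (letter : PairIndex n → Fin n × Bool) := by
  rintro ⟨i, κ⟩ ⟨j, μ⟩ h
  rcases Int.units_eq_one_or i with rfl | rfl <;> rcases Int.units_eq_one_or j with rfl | rfl <;>
    simp_all [letter]

/-- The left-hand side is the form in which `FreeGroup.IsReduced` constrains adjacent letters. -/
theorem letter_ne_bar_iff (x y : PairIndex n) :
    (x.letter.1 = y.letter.1 → x.letter.2 = y.letter.2) ↔ y ≠ x.bar := by
  obtain ⟨i, κ⟩ := x
  obtain ⟨j, μ⟩ := y
  rcases Int.units_eq_one_or i with rfl | rfl <;> rcases Int.units_eq_one_or j with rfl | rfl <;>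
    simp [letter, bar, eq_comm]

end PairIndex

theorem wordProd_eq_mk (xs : List (PairIndex n)) :
    wordProd xs = FreeGroup.mk (xs.map letter) := by
  induction xs with
  | nil => rfl
  | cons x xs ih =>
    rw [wordProd, List.map_cons, List.prod_cons, ← wordProd, ih, ← mk_letter, FreeGroup.mul_mk]
    rfl

/-- A list of indices without adjacent inverse pairs. -/
def ReducedList (xs : List (PairIndex n)) : Prop := xs.IsChain fun x y => y ≠ x.bar

theorem ReducedList.toWord_eq {xs : List (PairIndex n)} (h : ReducedList xs) :
    (wordProd xs).toWord = xs.map letter := by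
  rw [wordProd_eq_mk, FreeGroup.toWord_mk, FreeGroup.IsReduced.reduce_eq]
  exact (List.isChain_map letter).mpr (h.imp fun x y hxy => (letter_ne_bar_iff x y).mpr hxy)

theorem exists_reducedList (γ : FreeGroup (Fin n)) : ∃ xs, ReducedList xs ∧ γ = wordProd xs := by
  obtain ⟨xs, hxs⟩ := letter_surjective.list_map γ.toWord
  refine ⟨xs, ?_, ?_⟩
  · have h := FreeGroup.isReduced_toWord (x := γ)
    rw [← hxs] at h
    exact ((List.isChain_map letter).mp h).imp fun x y hxy => (letter_ne_bar_iff x y).mp hxy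
  · rw [wordProd_eq_mk, hxs, FreeGroup.mk_toWord]

theorem ReducedList.blocks_eq {xs : List (PairIndex n)} (h : ReducedList xs) :
    blocks (wordProd xs) = ((xs.map Prod.snd).splitBy (· == ·)).map List.length := by
  rw [blocks, h.toWord_eq, List.map_map]
  rfl

/-- Two words have the same pattern if adjacent letters are equal, or inverse to each other, at the
same positions. -/
inductive SamePattern : List (PairIndex n) → List (PairIndex n) → Prop
  | nil : SamePattern [] []
  | single (x z) : SamePattern [x] [z]
  | cons {x y z w xs zs} : (y = x ↔ w = z) → (y = x.bar ↔ w = z.bar) →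
      SamePattern (y :: xs) (w :: zs) → SamePattern (x :: y :: xs) (z :: w :: zs)

namespace SamePattern

theorem reducedList {xs zs : List (PairIndex n)} (h : SamePattern xs zs) (hz : ReducedList zs) :
    ReducedList xs := by
  induction h with
  | nil => exact hz
  | single x z => exact List.isChain_singleton x
  | cons _ h2 _ ih =>
    rw [ReducedList, List.isChain_cons_cons] at hz ⊢
    exact ⟨mt h2.mp hz.1, ih hz.2⟩

/-- Block lengths depend only on the positions where adjacent letters share a generator. Sharing a
generator means being equal or mutually inverse, which is what the pattern records. -/
theorem blocks_eq {xs zs : List (PairIndex n)} (h : SamePattern xs zs) (hz : ReducedList zs) :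
    blocks (wordProd xs) = blocks (wordProd zs) := by
  rw [(h.reducedList hz).blocks_eq, hz.blocks_eq]
  clear hz
  induction h with
  | nil => rfl
  | single x z => rfl
  | @cons x y z w xs zs h1 h2 h ih =>
    have h3 : y.2 = x.2 ↔ w.2 = z.2 := by
      rw [← eq_or_eq_bar_iff, ← eq_or_eq_bar_iff, h1, h2]
    simp only [List.map_cons] at ih ⊢
    rw [map_length_splitBy_cons_cons, map_length_splitBy_cons_cons, ih]
    simp only [h3]

end SamePattern

theorem wordProd_pair (x y : PairIndex n) : wordProd [x, y] = x.elt * y.elt := by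
  simp [wordProd]

theorem reducedList_pair {x y : PairIndex n} (h : y ≠ x.bar) : ReducedList [x, y] :=
  List.isChain_pair.mpr h

/-- The square of a letter is a reduced word, so uniqueness of reduced words determines both
factors. -/
theorem elt_mul_elt_eq_iff {a b x : PairIndex n} :
    a.elt * b.elt = x.elt * x.elt ↔ a = x ∧ b = x := by
  refine ⟨fun h => ?_, by rintro ⟨rfl, rfl⟩; rfl⟩
  have h2 := (reducedList_pair (bar_ne_self x).symm).toWord_eq
  rw [wordProd_pair, ← h] at h2
  by_cases hb : b = a.bar
  · rw [hb, elt_bar, mul_inv_cancel, FreeGroup.toWord_one] at h2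
    simp at h2
  · rw [← wordProd_pair, (reducedList_pair hb).toWord_eq] at h2
    simpa [letter_injective.eq_iff] using h2

theorem blockLength_elt_mul_elt {x y : PairIndex n} (h : y ≠ x.bar) :
    blockLength (x.elt * y.elt) = if y.2 = x.2 then 1 else 2 := by
  rw [blockLength, ← wordProd_pair, (reducedList_pair h).blocks_eq, List.map_cons, List.map_cons,
    List.map_nil, map_length_splitBy_cons_cons]
  split_ifs <;> rfl

theorem norm_elt_mul_elt {x y : PairIndex n} (h : y ≠ x.bar) : (x.elt * y.elt).norm = 2 := by
  rw [FreeGroup.norm, ← wordProd_pair, (reducedList_pair h).toWord_eq]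
  rfl

theorem length_shape (γ : FreeGroup (Fin n)) : (shape γ).length = blockLength γ := by
  simp [shape, blockLength]

/-! ### The images of words -/

section Images

open GroupCStar

variable {A : Type u} [CStarAlgebra A] {U : Matrix (PairIndex n) (PairIndex n) A}

variable (U) in
/-- The element `∏ j, ∑ x, γ_x ⊗ U x z_j` of the algebraic tensor product. -/
def wordImage (zs : List (PairIndex n)) : MonoidAlgebra ℂ (FreeGroup (Fin n)) ⊗[ℂ] A :=
  (zs.map fun z => ∑ x : PairIndex n, MonoidAlgebra.single x.elt 1 ⊗ₜ[ℂ] U x z).prod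

variable (U) in
/-- The product `∏ j, U x_j z_j`. -/
def entryProd (xs zs : List (PairIndex n)) : A := (List.zipWith (fun x z => U x z) xs zs).prod

theorem entryProd_cons (x z : PairIndex n) (xs zs : List (PairIndex n)) :
    entryProd U (x :: xs) (z :: zs) = U x z * entryProd U xs zs := by
  simp [entryProd]

theorem wordImage_cons (z : PairIndex n) (zs : List (PairIndex n)) : wordImage U (z :: zs) =
    (∑ x : PairIndex n, MonoidAlgebra.single x.elt 1 ⊗ₜ[ℂ] U x z) * wordImage U zs := by
  simp [wordImage]

variable (hH : IsHyperoctahedral U)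
include hH

theorem IsStandardFormula.apply_wordProd {α : GroupCStar.{u} (FreeGroup (Fin n)) →⋆ₐ[ℂ]
    SpatialTensor.{u} (GroupCStar.{u} (FreeGroup (Fin n))) A} (hα : IsStandardFormula U α)
    (zs : List (PairIndex n)) : α (of (wordProd zs)) = algIncl (wordImage U zs) := by
  induction zs with
  | nil => rw [show wordProd ([] : List (PairIndex n)) = 1 from rfl, of_one, map_one,
      show wordImage U [] = 1 from rfl, algIncl_one]
  | cons z zs ih =>
    rw [show wordProd (z :: zs) = z.elt * wordProd zs by simp [wordProd], of_mul, map_mul, ih,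
      wordImage_cons, algIncl_mul, hα.apply_elt hH, genImage]
    simp only [algIncl_eq, map_sum]
    rfl

/-- Expanding the product gives one term for each word `xs`; those violating the pattern contain two
adjacent entries with zero product. Membership in an additive closure avoids indexing the surviving
terms. -/
theorem wordImage_mem_closure (hU : U ∈ unitary (Matrix (PairIndex n) (PairIndex n) A))
    (hN : ∀ x z, IsStarNormal (U x z)) (zs : List (PairIndex n)) :
    wordImage U zs ∈ AddSubmonoid.closure {t | ∃ xs, SamePattern xs zs ∧
      t = MonoidAlgebra.single (wordProd xs) 1 ⊗ₜ[ℂ] entryProd U xs zs} := by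
  induction zs with
  | nil => exact AddSubmonoid.subset_closure ⟨[], .nil, rfl⟩
  | cons z zs ih =>
    rw [wordImage_cons, Finset.sum_mul]
    generalize wordImage U zs = t at ih ⊢
    refine sum_mem fun x _ => ?_
    induction ih using AddSubmonoid.closure_induction with
    | zero => rw [mul_zero]; exact zero_mem _
    | add s t _ _ hs ht => rw [mul_add]; exact add_mem hs ht
    | mem t ht =>
      obtain ⟨xs, hxs, rfl⟩ := ht
      rw [Algebra.TensorProduct.tmul_mul_tmul, MonoidAlgebra.single_mul_single, one_mul]
      have hmem : SamePattern (x :: xs) (z :: zs) →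
          MonoidAlgebra.single (x.elt * wordProd xs) 1 ⊗ₜ[ℂ] (U x z * entryProd U xs zs) ∈
          AddSubmonoid.closure {t | ∃ xs, SamePattern xs (z :: zs) ∧
            t = (MonoidAlgebra.single (wordProd xs) 1 : MonoidAlgebra ℂ _) ⊗ₜ[ℂ]
              entryProd U xs (z :: zs)} := fun h =>
        AddSubmonoid.subset_closure ⟨x :: xs, h, by simp [wordProd, entryProd_cons]⟩
      cases hxs with
      | nil => exact hmem (.single x z)
      | single y w =>
        -- Only the junction between the new letter and the head of the old word has to be examined.
        by_cases h : U x z * U y w = 0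
        · rw [entryProd_cons, ← mul_assoc, h, zero_mul, TensorProduct.tmul_zero]
          exact zero_mem _
        · have hp := hH.pattern_of_mul_ne_zero hU hN h
          exact hmem (.cons hp.1 hp.2 (.single y w))
      | @cons y y' w w' xs zs h1 h2 hxs =>
        by_cases h : U x z * U y w = 0
        · rw [entryProd_cons, ← mul_assoc, h, zero_mul,
            TensorProduct.tmul_zero]
          exact zero_mem _
        · have hp := hH.pattern_of_mul_ne_zero hU hN h
          exact hmem (.cons hp.1 hp.2 (.cons h1 h2 hxs))

-- Only the pair `(x, x)` of letters multiplies to `x.elt * x.elt`, so a single term contributes.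
omit hH in
theorem coeffMap_wordImage_pair (x z w : PairIndex n) :
    coeffMap (x.elt * x.elt) (wordImage U [z, w]) = U x z * U x w := by
  classical
  have h : wordImage U [z, w] = ∑ a : PairIndex n, ∑ b : PairIndex n,
      MonoidAlgebra.single (a.elt * b.elt) 1 ⊗ₜ[ℂ] (U a z * U b w) := by
    simp [wordImage, Finset.sum_mul_sum, MonoidAlgebra.single_mul_single]
  simp only [h, map_sum, coeffMap_single_tmul, one_smul, elt_mul_elt_eq_iff]
  rw [Finset.sum_eq_single x _ (by simp)]
  · simp
  · intro a _ ha
    simp [ha]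

end Images

/-! ### The equivalent conditions -/

section Main

variable {A : Type u} [CStarAlgebra A] {U : Matrix (PairIndex n) (PairIndex n) A}
  {α : GroupCStar.{u} (FreeGroup (Fin n)) →⋆ₐ[ℂ]
    SpatialTensor.{u} (GroupCStar.{u} (FreeGroup (Fin n))) A}

theorem preservesOn_shape_of_normal (hH : IsHyperoctahedral U)
    (hU : U ∈ unitary (Matrix (PairIndex n) (PairIndex n) A)) (hα : IsStandardFormula U α)
    (hN : ∀ x z, IsStarNormal (U x z)) : PreservesOn α Set.univ shape := by
  classical
  intro γ _
  obtain ⟨zs, hz, rfl⟩ := exists_reducedList γ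
  refine ⟨wordImage U zs, hα.apply_wordProd hH zs, fun γ' hγ' => ?_⟩
  have ht := wordImage_mem_closure hH hU hN zs
  generalize wordImage U zs = t at ht ⊢
  induction ht using AddSubmonoid.closure_induction with
  | zero => exact map_zero _
  | add s t _ _ hs ht => rw [map_add, hs, ht, add_zero]
  | mem t ht =>
    obtain ⟨xs, hxs, rfl⟩ := ht
    rw [coeffMap_single_tmul, if_neg]
    rintro rfl
    exact hγ' (by rw [shape, shape, hxs.blocks_eq hz])

theorem PreservesOn.blockLength_of_shape (h : PreservesOn α Set.univ shape) :
    PreservesOn α Set.univ blockLength := fun γ hγ => by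
  obtain ⟨t, ht, ht'⟩ := h γ hγ
  exact ⟨t, ht, fun γ' hγ' => ht' γ' fun he => hγ' (by
    rw [← length_shape, ← length_shape, he])⟩

/-- The obstruction to normality, `U x z * U x w` with `z ≠ w`, is the coefficient of a one-block
element in the image of a two-block element. The exception is `w = z.bar`, where the product
vanishes in any case. -/
theorem normal_of_preservesOn (hH : IsHyperoctahedral U)
    (hU : U ∈ unitary (Matrix (PairIndex n) (PairIndex n) A)) (hα : IsStandardFormula U α)
    (h : PreservesOn α {γ | blockLength γ = 2 ∧ γ.norm = 2} blockLength) (x z : PairIndex n) :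
    IsStarNormal (U x z) := by
  refine hH.isStarNormal_of_mul_eq_zero hU (fun x z w hzw => ?_) x z
  by_cases hw : w = z.bar
  · rw [hw]
    exact hH.mul_eq_zero_of_col hU (bar_ne_self x).symm
  · have h2 : w.2 ≠ z.2 := fun e => (eq_or_eq_bar_iff.mpr e).elim hzw.symm hw
    have hb : blockLength (z.elt * w.elt) = 2 := by rw [blockLength_elt_mul_elt hw, if_neg h2]
    obtain ⟨t, ht, ht'⟩ := h (z.elt * w.elt) ⟨hb, norm_elt_mul_elt hw⟩
    rw [← wordProd_pair, hα.apply_wordProd hH] at ht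
    -- The hypothesis concerns its own representative `t`; uniqueness of coefficients transfers the
    -- vanishing to the explicit expansion.
    rw [← coeffMap_wordImage_pair, coeffMap_eq_of_algIncl_eq ht]
    exact ht' _ (by simp [hb, blockLength_elt_mul_elt (bar_ne_self x).symm])

end Main

end

theorem lemma5p2 (n : ℕ) {A : Type u} [CStarAlgebra A] (G : CompactQuantumGroup A)
    (U : Matrix (PairIndex n) (PairIndex n) A) (hU : G.IsFundamentalRep U)
    (hH : IsHyperoctahedral U) :
    (∃! α : GroupCStar.{u} (FreeGroup (Fin n)) →⋆ₐ[ℂ]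
        SpatialTensor.{u} (GroupCStar.{u} (FreeGroup (Fin n))) A,
      G.IsAction α ∧ IsStandardFormula U α) ∧
    ∀ α : GroupCStar.{u} (FreeGroup (Fin n)) →⋆ₐ[ℂ]
        SpatialTensor.{u} (GroupCStar.{u} (FreeGroup (Fin n))) A,
      G.IsAction α → IsStandardFormula U α →
      List.TFAE
        [flipOp n ∈ HomTensorSquare U,
         ∀ x z, IsStarNormal (U x z),
         PreservesOn α {γ | blockLength γ = 2 ∧ γ.norm = 2} blockLength,
         PreservesOn α Set.univ blockLength,
         PreservesOn α Set.univ shape] := by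
  refine ⟨?_, fun α _ hα => ?_⟩
  · obtain ⟨α, hα⟩ := exists_isStandardFormula hH hU.unitary
    exact ⟨α, ⟨hα.isAction hH hU, hα⟩, fun β hβ => hβ.2.unique hH hα⟩
  · tfae_have 1 ↔ 2 := hH.flipOp_mem_iff hU.unitary
    tfae_have 2 → 5 := preservesOn_shape_of_normal hH hU.unitary hα
    tfae_have 5 → 4 := PreservesOn.blockLength_of_shape
    tfae_have 4 → 3 := fun h γ _ => h γ trivial
    tfae_have 3 → 2 := normal_of_preservesOn hH hU.unitary hα
    tfae_finish
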